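/- Let $Y$ be a connected smooth manifold (Hausdorff, second countable, finite-dimensional, without boundary), and let $(\omega,b)$ be a locally conformal pre-symplectic (l.c.p-s.) form on $Y$: $b$ is a closed $1$-form and $\omega$ is a $2$-form of constant rank with $d^b\omega:=d\omega+b\wedge\omega=0$. Let $\mathcal F$ be its null foliation, whose tangent distribution is $T\mathcal F=\ker\omega$. An infinitesimal bulk deformation of $(\omega,b)$ is a pair $(\kappa,c)\in\Omega^2(Y)\times\Omega^1(Y)$ with $$d^b\kappa=-c\wedge\omega,\qquad dc=0,\qquad \kappa|_{\mathcal F}=0 .$$ Two of them, $(\kappa',c')$ and $(\kappa,c)$, are equivalent if there are a vector field $\xi$ on $Y$ and $f\in C^\infty(Y)$ with $$\kappa'=-f\,\omega+\kappa+\mathcal L_\xi\omega,\qquad c'=c+\mathcal L_\xi b+df .$$ Let $\mathrm{Def}(Y,\omega,b)$ be the real vector space of equivalence classes. Let $\Omega^\ast(Y,\omega,\mathcal F)\subset\Omega^\ast(Y)$ be the differential ideal of forms generated (locally) by the annihilator $T\mathcal F^\circ\subset\Omega^1(Y)$ of $T\mathcal F$; it is a subcomplex for $d^b$ and contains $\omega$.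 Let $$H^i_b(Y,\omega,\mathcal F)=\frac{\ker d^b\cap\Omega^i(Y,\omega,\mathcal F)}{d^b\,\Omega^{i-1}(Y,\omega,\mathcal F)},$$ let $\langle\omega\rangle_{\mathbb R}$ be the line spanned by the class of $\omega$ in $H^2_b(Y,\omega,\mathcal F)$, and let $$L:H^1(Y;\mathbb R)\to H^3_b(Y,\omega,\mathcal F),\qquad [\gamma]\mapsto[\gamma\wedge\omega],$$ where $H^1(Y;\mathbb R)$ is the first de Rham cohomology. Then there is an isomorphism of real vector spaces $$\mathrm{Def}(Y,\omega,b)\;\cong\; H^2_b(Y,\omega,\mathcal F)/\langle\omega\rangle_{\mathbb R}\;\oplus\;\ker L .$$ -/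

import Mathlib

open scoped Manifold ContDiff

noncomputable section

namespace LCPS

open Function

section Subquotient

/-- The subquotient `Z / (B ∩ Z)` of a real vector space. In all uses below `B` is contained in `Z`,
so that this is `Z / B`. -/
def Subquotient {V : Type*} [AddCommGroup V] [Module ℝ V] (Z B : Submodule ℝ V) : Type _ :=
  Z ⧸ B.submoduleOf Z

variable {V W : Type*} [AddCommGroup V] [Module ℝ V] [AddCommGroup W] [Module ℝ W]

instance (Z B : Submodule ℝ V) : AddCommGroup (Subquotient Z B) :=
  inferInstanceAs (AddCommGroup (Z ⧸ B.submoduleOf Z))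

instance (Z B : Submodule ℝ V) : Module ℝ (Subquotient Z B) :=
  inferInstanceAs (Module ℝ (Z ⧸ B.submoduleOf Z))

/-- The class of an element of `Z` in `Z / B`. -/
def Subquotient.mk (Z B : Submodule ℝ V) : Z →ₗ[ℝ] Subquotient Z B :=
  (B.submoduleOf Z).mkQ

/-- The linear map of subquotients induced by a linear map. -/
def Subquotient.map {Z B : Submodule ℝ V} {Z' B' : Submodule ℝ W} (f : V →ₗ[ℝ] W)
    (hZ : ∀ x ∈ Z, f x ∈ Z') (hB : ∀ x ∈ B, f x ∈ B') : Subquotient Z B →ₗ[ℝ] Subquotient Z' B' :=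
  Submodule.mapQ (B.submoduleOf Z) (B'.submoduleOf Z') (f.restrict hZ)
    (fun x hx => hB x hx)

end Subquotient

section Algebra
variable {A : Type*} [CommRing A] [Algebra ℝ A]

/-- The vector fields attached to the algebra `A`, as derivations. For `A = C^∞(Y)` these are exactly
the smooth vector fields of the manifold `Y`, and `⁅X, Z⁆` is their Lie bracket `X ∘ Z - Z ∘ X`. -/
abbrev VectorField (A : Type*) [CommRing A] [Algebra ℝ A] : Type _ := Derivation ℝ A A

/-- Differential forms of degree `k`: alternating `A`-multilinear maps on vector fields with values in
`A`. For `A = C^∞(Y)` these are exactly the smooth differential `k`-forms on `Y`. -/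
abbrev Form (A : Type*) [CommRing A] [Algebra ℝ A] (k : ℕ) : Type _ :=
  VectorField A [⋀^Fin k]→ₗ[A] A

instance {k : ℕ} : IsScalarTower ℝ A (Form A k) :=
  ⟨fun c f η => by ext v; simp⟩

/-- A function as a form of degree `0`. -/
def ofFun (f : A) : Form A 0 := AlternatingMap.constOfIsEmpty A (VectorField A) (Fin 0) f

/-- The wedge product of a `1`-form and a `k`-form,
`(α ∧ η)(v₀, …, v_k) = ∑ i, (-1)^i α(v_i) η(v₀, …, omit v_i, …, v_k)`; see `wedge_apply`. -/
def wedge {k : ℕ} (α : Form A 1) (η : Form A k) : Form A (k + 1) :=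
  AlternatingMap.alternatizeUncurryFin
    { toFun := fun X => α ![X] • η
      map_add' := fun X Y => by
        rw [← add_smul]; congr 1; exact α.map_vecCons_add ![] X Y
      map_smul' := fun f X => by
        rw [RingHom.id_apply, smul_smul, ← smul_eq_mul]; congr 1
        exact α.map_vecCons_smul ![] f X }

theorem wedge_apply {k : ℕ} (α : Form A 1) (η : Form A k) (v : Fin (k + 1) → VectorField A) :
    wedge α η v = ∑ i : Fin (k + 1), (-1) ^ (i : ℕ) • (α ![v i] * η (i.removeNth v)) := by
  rw [wedge, AlternatingMap.alternatizeUncurryFin_apply]; rfl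

theorem bracket_smul' (X Y : VectorField A) (f : A) : ⁅X, f • Y⁆ = X f • Y + f • ⁅X, Y⁆ := by
  ext g
  simp [Derivation.commutator_apply, mul_sub]
  ring

theorem lie_sum_update {k : ℕ} (η : Form A k) (X : VectorField A)
    (v : Fin k → VectorField A) (i : Fin k) (z : VectorField A) :
    ∑ j, η (update (update v i z) j ⁅X, update v i z j⁆) =
      η (update v i ⁅X, z⁆) + ∑ j ∈ Finset.univ.erase i, η (update (update v j ⁅X, v j⁆) i z) := by
  rw [← Finset.add_sum_erase _ _ (Finset.mem_univ i)]
  congr 1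
  · simp
  · refine Finset.sum_congr rfl fun j hj => ?_
    have hj' : j ≠ i := (Finset.mem_erase.1 hj).1
    rw [update_of_ne hj', update_comm hj']

/-- The Lie derivative of a form along `X`,
`(L_X η)(v₁, …, v_k) = X (η(v₁, …, v_k)) - ∑ j, η(v₁, …, [X, v_j], …, v_k)`. -/
def lieDeriv {k : ℕ} (X : VectorField A) (η : Form A k) : Form A k where
  toFun v := X (η v) - ∑ j, η (update v j ⁅X, v j⁆)
  map_update_add' := by
    intro inst v i x y
    obtain rfl : inst = instDecidableEqFin k := Subsingleton.elim _ _
    rw [lie_sum_update, lie_sum_update, lie_sum_update]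
    simp only [AlternatingMap.map_update_add, map_add, lie_add, Finset.sum_add_distrib]
    ring
  map_update_smul' := by
    intro inst v i f x
    obtain rfl : inst = instDecidableEqFin k := Subsingleton.elim _ _
    rw [lie_sum_update, lie_sum_update, bracket_smul']
    simp only [AlternatingMap.map_update_add, AlternatingMap.map_update_smul, smul_eq_mul,
      Derivation.leibniz, ← Finset.mul_sum]
    ring
  map_eq_zero_of_eq' := by
    intro v a b hab hne
    have h0 : η v = 0 := η.map_eq_zero_of_eq v hab hne
    have hsum : ∑ j, η (update v j ⁅X, v j⁆) =
        η (update v a ⁅X, v a⁆) + η (update v b ⁅X, v b⁆) := by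
      refine Fintype.sum_eq_add a b hne fun j hj => ?_
      exact η.map_eq_zero_of_eq _ (by simp [update_of_ne hj.1.symm, update_of_ne hj.2.symm, hab]) hne
    have hsw : update v b ⁅X, v b⁆ = update v a ⁅X, v a⁆ ∘ Equiv.swap a b := by
      funext j
      by_cases ha : j = a
      · subst ha; simp [update_of_ne hne, update_of_ne hne.symm, hab]
      · by_cases hb : j = b
        · subst hb; simp [hab]
        · simp [Equiv.swap_apply_of_ne_of_ne ha hb, ha, hb]
    rw [hsum, hsw, AlternatingMap.map_swap _ _ hne]
    simp [h0]

theorem lieDeriv_apply {k : ℕ} (X : VectorField A) (η : Form A k) (v : Fin k → VectorField A) :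
    lieDeriv X η v = X (η v) - ∑ j, η (update v j ⁅X, v j⁆) := rfl

theorem lieDeriv_add_left {k : ℕ} (X Y : VectorField A) (η : Form A k) :
    lieDeriv (X + Y) η = lieDeriv X η + lieDeriv Y η := by
  ext v
  simp only [lieDeriv_apply, AlternatingMap.add_apply, Derivation.add_apply, add_lie,
    AlternatingMap.map_update_add, Finset.sum_add_distrib]
  ring

theorem map_update_real {k : ℕ} (η : Form A k) (c : ℝ) (v : Fin k → VectorField A) (j : Fin k)
    (x : VectorField A) : η (update v j (c • x)) = c • η (update v j x) := by
  rw [← algebraMap_smul A c x, AlternatingMap.map_update_smul, algebraMap_smul]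

theorem map_cons_real {k : ℕ} (η : Form A (k + 1)) (c : ℝ) (X : VectorField A)
    (w : Fin k → VectorField A) :
    η (Matrix.vecCons (c • X) w) = c • η (Matrix.vecCons X w) := by
  rw [← algebraMap_smul A c X, AlternatingMap.map_vecCons_smul, algebraMap_smul]

theorem lieDeriv_smul_left {k : ℕ} (c : ℝ) (X : VectorField A) (η : Form A k) :
    lieDeriv (c • X) η = c • lieDeriv X η := by
  ext v
  simp only [lieDeriv_apply, AlternatingMap.smul_apply, Derivation.smul_apply, smul_lie,
    map_update_real, ← Finset.smul_sum, smul_sub]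

theorem lieDeriv_add {k : ℕ} (X : VectorField A) (η θ : Form A k) :
    lieDeriv X (η + θ) = lieDeriv X η + lieDeriv X θ := by
  ext v
  simp only [lieDeriv_apply, AlternatingMap.add_apply, map_add, Finset.sum_add_distrib]
  ring

theorem lieDeriv_smul_fun {k : ℕ} (X : VectorField A) (f : A) (η : Form A k) :
    lieDeriv X (f • η) = X f • η + f • lieDeriv X η := by
  ext v
  simp only [lieDeriv_apply, AlternatingMap.add_apply, AlternatingMap.smul_apply, smul_eq_mul,
    Derivation.leibniz, ← Finset.mul_sum]
  ring

theorem lieDeriv_fun_smul {k : ℕ} (X : VectorField A) (f : A) (η : Form A (k + 1))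
    (w : Fin (k + 1) → VectorField A) :
    lieDeriv (f • X) η w = f * lieDeriv X η w + ∑ j, w j f * η (update w j X) := by
  have h : ∀ j, η (update w j ⁅f • X, w j⁆) =
      f * η (update w j ⁅X, w j⁆) - w j f * η (update w j X) := by
    intro j
    have : ⁅f • X, w j⁆ = f • ⁅X, w j⁆ + (-(w j f)) • X := by
      ext g
      simp only [Derivation.commutator_apply, Derivation.add_apply, Derivation.smul_apply,
        Derivation.leibniz, smul_eq_mul]
      ring
    rw [this, AlternatingMap.map_update_add, AlternatingMap.map_update_smul,
      AlternatingMap.map_update_smul]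
    simp [sub_eq_add_neg]
  simp only [lieDeriv_apply, h, Finset.sum_sub_distrib, Derivation.smul_apply, smul_eq_mul,
    ← Finset.mul_sum]
  ring

/-- A form regarded as a real alternating map. -/
def realForm {k : ℕ} (η : Form A k) : VectorField A [⋀^Fin k]→ₗ[ℝ] A :=
  { η.toMultilinearMap.restrictScalars ℝ with map_eq_zero_of_eq' := η.map_eq_zero_of_eq' }

theorem realForm_apply {k : ℕ} (η : Form A k) (v : Fin k → VectorField A) :
    realForm η v = η v := rfl

/-- The exterior derivative as a real alternating map (auxiliary, used to construct `extDeriv`). -/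
def realDeriv {k : ℕ} (η : Form A k) : VectorField A [⋀^Fin (k + 1)]→ₗ[ℝ] A :=
  (1 / 2 : ℝ) • AlternatingMap.alternatizeUncurryFin
    { toFun := fun X : VectorField A => (X : A →ₗ[ℝ] A).compAlternatingMap (realForm η) + realForm (lieDeriv X η)
      map_add' := fun X Y => by
        ext v
        simp only [realForm_apply, lieDeriv_add_left, AlternatingMap.add_apply,
          LinearMap.compAlternatingMap_apply, Derivation.coeFn_coe, Derivation.add_apply]
        ring
      map_smul' := fun c X => by
        ext v
        simp only [realForm_apply, lieDeriv_smul_left, AlternatingMap.add_apply,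
          LinearMap.compAlternatingMap_apply, Derivation.coeFn_coe, Derivation.smul_apply,
          AlternatingMap.smul_apply, RingHom.id_apply, smul_add] }

theorem realDeriv_apply {k : ℕ} (η : Form A k) (v : Fin (k + 1) → VectorField A) :
    realDeriv η v = (1 / 2 : ℝ) • ∑ i : Fin (k + 1), (-1) ^ (i : ℕ) •
      (v i (η (i.removeNth v)) + lieDeriv (v i) η (i.removeNth v)) := by
  rw [realDeriv, AlternatingMap.smul_apply, AlternatingMap.alternatizeUncurryFin_apply]; rfl

theorem half_smul_double (x : A) : (1 / 2 : ℝ) • (x + x) = x := by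
  rw [← two_smul ℝ x, smul_smul]; norm_num

theorem lieDeriv_cons {k : ℕ} (Z X : VectorField A) (η : Form A (k + 1))
    (u : Fin k → VectorField A) :
    lieDeriv Z η (Matrix.vecCons X u) =
      lieDeriv Z (η.curryLeft X) u - η (Matrix.vecCons ⁅Z, X⁆ u) := by
  simp only [lieDeriv_apply, Fin.sum_univ_succ, AlternatingMap.curryLeft_apply_apply]
  have h0 : update (Matrix.vecCons X u) 0 ⁅Z, X⁆ = Matrix.vecCons ⁅Z, X⁆ u := by
    simp [Matrix.vecCons]
  have hs : ∀ j, update (Matrix.vecCons X u) (Fin.succ j) ⁅Z, u j⁆ =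
      Matrix.vecCons X (update u j ⁅Z, u j⁆) := by
    intro j; simp [Matrix.vecCons, Fin.cons_update]
  simp only [Matrix.cons_val_zero, Matrix.cons_val_succ, h0, hs]
  ring

theorem removeNth_succ_vecCons {k : ℕ} (X : VectorField A) (w : Fin (k + 1) → VectorField A)
    (i : Fin (k + 1)) :
    (Fin.succ i).removeNth (Matrix.vecCons X w) = Matrix.vecCons X (i.removeNth w) := by
  funext j
  refine Fin.cases ?_ (fun j => ?_) j
  · simp [Fin.removeNth]
  · simp [Fin.removeNth]

theorem removeNth_zero_vecCons {k : ℕ} (X : VectorField A) (w : Fin k → VectorField A) :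
    (0 : Fin (k + 1)).removeNth (Matrix.vecCons X w) = w := by
  funext j; simp [Fin.removeNth]

theorem sign_smul_cons {k : ℕ} (η : Form A (k + 1)) (w : Fin (k + 1) → VectorField A)
    (X : VectorField A) (i : Fin (k + 1)) :
    (-1) ^ (i : ℕ) • η (Matrix.vecCons X (i.removeNth w)) = η (update w i X) := by
  rw [← AlternatingMap.map_insertNth, Fin.insertNth_removeNth]

theorem realDeriv_cons {k : ℕ} (η : Form A (k + 1)) (X : VectorField A)
    (w : Fin (k + 1) → VectorField A) :
    realDeriv η (Matrix.vecCons X w) = lieDeriv X η w - realDeriv (η.curryLeft X) w := by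
  have h : ∀ i : Fin (k + 1), ((-1) ^ (i : ℕ) • η (Matrix.vecCons ⁅w i, X⁆ (i.removeNth w)) : A) =
      - η (update w i ⁅X, w i⁆) := by
    intro i
    rw [sign_smul_cons, ← lie_skew, AlternatingMap.map_update_neg]
  rw [eq_sub_iff_add_eq, realDeriv_apply, realDeriv_apply, ← smul_add]
  conv_rhs => rw [← half_smul_double (lieDeriv X η w)]
  congr 1
  rw [Fin.sum_univ_succ]
  simp only [Matrix.cons_val_zero, Matrix.cons_val_succ, removeNth_succ_vecCons,
    removeNth_zero_vecCons, lieDeriv_cons, Fin.val_zero, pow_zero, one_smul, Fin.val_succ, pow_succ,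
    mul_neg, mul_one, neg_smul, AlternatingMap.curryLeft_apply_apply, smul_add, smul_sub, h,
    Finset.sum_neg_distrib, Finset.sum_add_distrib, Finset.sum_sub_distrib]
  rw [lieDeriv_apply]
  ring

theorem realDeriv_fun_smul {k : ℕ} (f : A) (η : Form A k) (v : Fin (k + 1) → VectorField A) :
    realDeriv (f • η) v =
      ∑ i : Fin (k + 1), (-1) ^ (i : ℕ) • (v i f * η (i.removeNth v)) + f * realDeriv η v := by
  rw [← half_smul_double (∑ i : Fin (k + 1), (-1) ^ (i : ℕ) • (v i f * η (i.removeNth v))),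
    realDeriv_apply, realDeriv_apply, mul_smul_comm, ← smul_add]
  congr 1
  rw [Finset.mul_sum, ← Finset.sum_add_distrib, ← Finset.sum_add_distrib]
  refine Finset.sum_congr rfl fun i _ => ?_
  simp only [lieDeriv_smul_fun, AlternatingMap.add_apply, AlternatingMap.smul_apply,
    Derivation.leibniz, smul_eq_mul, mul_smul_comm, ← smul_add]
  congr 1
  ring

theorem realDeriv_smul_cons {k : ℕ} (η : Form A k) (f : A) (X : VectorField A)
    (w : Fin k → VectorField A) :
    realDeriv η (Matrix.vecCons (f • X) w) = f * realDeriv η (Matrix.vecCons X w) := by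
  cases k with
  | zero =>
    simp only [realDeriv_apply, Fin.sum_univ_succ, lieDeriv_apply]
    simp [mul_add]
  | succ k =>
    have hc : η.curryLeft (f • X) = f • η.curryLeft X := by
      rw [map_smul]
    rw [realDeriv_cons, realDeriv_cons, hc, realDeriv_fun_smul, lieDeriv_fun_smul]
    have : ∀ i : Fin (k + 1), ((-1) ^ (i : ℕ) • (w i f * η.curryLeft X (i.removeNth w)) : A) =
        w i f * η (update w i X) := by
      intro i
      rw [← sign_smul_cons, mul_smul_comm, AlternatingMap.curryLeft_apply_apply]
    simp only [this]
    ring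

theorem realDeriv_smul {k : ℕ} (η : Form A k) (f : A) (v : Fin (k + 1) → VectorField A)
    (i : Fin (k + 1)) (x : VectorField A) :
    realDeriv η (update v i (f • x)) = f • realDeriv η (update v i x) := by
  rw [← Fin.insertNth_removeNth, ← Fin.insertNth_removeNth, AlternatingMap.map_insertNth,
    AlternatingMap.map_insertNth, realDeriv_smul_cons, smul_eq_mul, mul_smul_comm]

/-- The exterior derivative. Since `L_{v_i} η` contains `v_i(η(…))` once more together with all brackets
`[v_i, v_j]`, every pair of indices occurs twice in the brackets, and the right-hand side is the usual
`∑ i, (-1)^i v_i(η(…, omit v_i, …)) + ∑ i < j, (-1)^(i+j) η([v_i, v_j], …, omit v_i, v_j, …)`.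
See `extDeriv_ofFun`, `extDeriv_one_apply` for degrees `0` and `1`, and `curryLeft_extDeriv` for the
formula of Cartan, which determines `extDeriv` in all degrees. -/
def extDeriv {k : ℕ} (η : Form A k) : Form A (k + 1) where
  toFun v := (1 / 2 : ℝ) • ∑ i : Fin (k + 1), (-1) ^ (i : ℕ) •
      (v i (η (i.removeNth v)) + lieDeriv (v i) η (i.removeNth v))
  map_update_add' := by
    intro inst v i x y
    obtain rfl : inst = instDecidableEqFin (k + 1) := Subsingleton.elim _ _
    simp only [← realDeriv_apply]
    exact (realDeriv η).map_update_add v i x y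
  map_update_smul' := by
    intro inst v i f x
    obtain rfl : inst = instDecidableEqFin (k + 1) := Subsingleton.elim _ _
    simp only [← realDeriv_apply]
    exact realDeriv_smul η f v i x
  map_eq_zero_of_eq' := by
    intro v i j h hij
    simp only [← realDeriv_apply]
    exact (realDeriv η).map_eq_zero_of_eq v h hij

theorem extDeriv_eq {k : ℕ} (η : Form A k) (v : Fin (k + 1) → VectorField A) :
    extDeriv η v = realDeriv η v := (realDeriv_apply η v).symm

theorem extDeriv_ofFun (f : A) (X : VectorField A) : extDeriv (ofFun f) ![X] = X f := by
  rw [extDeriv_eq, realDeriv_apply]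
  simp only [Fin.sum_univ_succ, lieDeriv_apply]
  simp only [ofFun, AlternatingMap.constOfIsEmpty_apply, Finset.univ_eq_empty, Finset.sum_empty,
    sub_zero, add_zero, Fin.val_zero, pow_zero, one_smul, Matrix.cons_val_zero]
  exact half_smul_double _

/-- The formula of Cartan `ι_X d η = L_X η - d ι_X η`, where `ι_X η = η.curryLeft X`. -/
theorem curryLeft_extDeriv {k : ℕ} (X : VectorField A) (η : Form A (k + 1)) :
    (extDeriv η).curryLeft X = lieDeriv X η - extDeriv (η.curryLeft X) := by
  ext w
  rw [AlternatingMap.curryLeft_apply_apply, AlternatingMap.sub_apply, extDeriv_eq, extDeriv_eq,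
    realDeriv_cons]

theorem extDeriv_one_apply (α : Form A 1) (X Y : VectorField A) :
    extDeriv α ![X, Y] = X (α ![Y]) - Y (α ![X]) - α ![⁅X, Y⁆] := by
  have h := congrArg (fun θ => θ ![Y]) (curryLeft_extDeriv X α)
  have h0 : α.curryLeft X = ofFun (α ![X]) := by
    ext v; rw [Subsingleton.elim v ![]]; rfl
  simp only [AlternatingMap.curryLeft_apply_apply, AlternatingMap.sub_apply, h0, extDeriv_ofFun,
    lieDeriv_apply] at h
  rw [h]
  simp
  have : update ![Y] 0 ⁅X, Y⁆ = ![⁅X, Y⁆] := by ext i; fin_cases i; simp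
  rw [this]; ring

/-- The exterior derivative as a real linear map. -/
def extDerivₗ (A : Type*) [CommRing A] [Algebra ℝ A] (k : ℕ) : Form A k →ₗ[ℝ] Form A (k + 1) where
  toFun := extDeriv
  map_add' η θ := by
    ext v
    simp only [extDeriv_eq, realDeriv_apply, AlternatingMap.add_apply, lieDeriv_add, map_add,
      ← smul_add, ← Finset.sum_add_distrib]
    congr 1
    refine Finset.sum_congr rfl fun i _ => ?_
    congr 1; ring
  map_smul' c η := by
    ext v
    have hc : c • η = algebraMap ℝ A c • η := by rw [algebraMap_smul]
    rw [RingHom.id_apply, hc, extDeriv_eq, realDeriv_fun_smul, AlternatingMap.smul_apply,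
      extDeriv_eq]
    simp [Algebra.smul_def]

theorem curryLeft_wedge {k : ℕ} (X : VectorField A) (α : Form A 1) (η : Form A (k + 1)) :
    (wedge α η).curryLeft X = α ![X] • η - wedge α (η.curryLeft X) := by
  ext w
  rw [AlternatingMap.curryLeft_apply_apply, AlternatingMap.sub_apply, wedge_apply, wedge_apply,
    Fin.sum_univ_succ]
  simp only [Matrix.cons_val_zero, Matrix.cons_val_succ, removeNth_succ_vecCons,
    removeNth_zero_vecCons, Fin.val_zero, pow_zero, one_smul, Fin.val_succ, pow_succ,
    mul_neg, mul_one, neg_smul, AlternatingMap.curryLeft_apply_apply,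
    Finset.sum_neg_distrib, AlternatingMap.smul_apply, smul_eq_mul]
  ring

theorem form_ext {k : ℕ} {η θ : Form A (k + 1)} (h : ∀ X, η.curryLeft X = θ.curryLeft X) :
    η = θ := by
  ext v
  have := congrArg (fun ζ => ζ (Matrix.vecTail v)) (h (Matrix.vecHead v))
  simpa [AlternatingMap.curryLeft_apply_apply] using this

theorem wedge_zero_form (α : Form A 1) (η : Form A 0) :
    wedge α η = η ![] • α := by
  ext v
  rw [wedge_apply]
  simp only [Fin.sum_univ_succ]
  have h1 : (0 : Fin 1).removeNth v = ![] := Subsingleton.elim _ _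
  have h2 : ![v 0] = v := by ext i; fin_cases i; rfl
  simp [h1, h2, mul_comm]

theorem wedge_add {k : ℕ} (α : Form A 1) (η θ : Form A k) :
    wedge α (η + θ) = wedge α η + wedge α θ := by
  ext v
  simp only [wedge_apply, AlternatingMap.add_apply, mul_add, smul_add, Finset.sum_add_distrib]

theorem add_wedge {k : ℕ} (α β : Form A 1) (η : Form A k) :
    wedge (α + β) η = wedge α η + wedge β η := by
  ext v
  simp only [wedge_apply, AlternatingMap.add_apply, add_mul, smul_add, Finset.sum_add_distrib]

theorem wedge_smul {k : ℕ} (f : A) (α : Form A 1) (η : Form A k) :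
    wedge α (f • η) = f • wedge α η := by
  ext v
  simp only [wedge_apply, AlternatingMap.smul_apply, smul_eq_mul, Finset.mul_sum,
    mul_left_comm (α _) f, mul_smul_comm]

theorem smul_wedge {k : ℕ} (f : A) (α : Form A 1) (η : Form A k) :
    wedge (f • α) η = f • wedge α η := by
  ext v
  simp only [wedge_apply, AlternatingMap.smul_apply, smul_eq_mul, Finset.mul_sum,
    mul_smul_comm, mul_assoc]

theorem wedge_sub {k : ℕ} (α : Form A 1) (η θ : Form A k) :
    wedge α (η - θ) = wedge α η - wedge α θ := by
  ext v
  simp only [wedge_apply, AlternatingMap.sub_apply, mul_sub, smul_sub, Finset.sum_sub_distrib]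

theorem zero_wedge {k : ℕ} (η : Form A k) : wedge 0 η = 0 := by
  ext v
  simp [wedge_apply]

theorem wedge_zero {k : ℕ} (α : Form A 1) : wedge α (0 : Form A k) = 0 := by
  ext v
  simp [wedge_apply]

theorem curryLeft_neg' {k : ℕ} (X : VectorField A) (η : Form A (k + 1)) :
    (-η).curryLeft X = -(η.curryLeft X) := rfl

theorem curryLeft_one (X : VectorField A) (α : Form A 1) : α.curryLeft X = ofFun (α ![X]) := by
  ext v; rw [Subsingleton.elim v ![]]; rfl

theorem wedge_ofFun (α : Form A 1) (f : A) : wedge α (ofFun f) = f • α := by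
  rw [wedge_zero_form]; rfl

theorem eq_ofFun (η : Form A 0) : η = ofFun (η ![]) := by
  ext v; rw [Subsingleton.elim v ![]]; rfl

theorem wedge_wedge {k : ℕ} (α β : Form A 1) (η : Form A k) :
    wedge α (wedge β η) = - wedge β (wedge α η) := by
  induction k with
  | zero =>
    refine form_ext fun X => ?_
    rw [eq_ofFun η, curryLeft_neg']
    simp only [curryLeft_wedge, curryLeft_one, wedge_ofFun, AlternatingMap.smul_apply, smul_eq_mul,
      smul_smul, mul_comm]
    abel
  | succ k ih =>
    refine form_ext fun X => ?_
    rw [curryLeft_neg']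
    simp only [curryLeft_wedge, wedge_sub, wedge_smul]
    rw [ih]
    abel

theorem wedge_comm_one (α β : Form A 1) : wedge α β = - wedge β α := by
  have h := wedge_wedge α β (ofFun 1)
  simpa [wedge_ofFun] using h

theorem curryLeft_lieDeriv {k : ℕ} (X Y : VectorField A) (η : Form A (k + 1)) :
    (lieDeriv X η).curryLeft Y = lieDeriv X (η.curryLeft Y) - η.curryLeft ⁅X, Y⁆ := by
  ext w
  exact lieDeriv_cons X Y η w

theorem lieDeriv_ofFun (X : VectorField A) (f : A) : lieDeriv X (ofFun f) = ofFun (X f) := by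
  ext v
  simp [lieDeriv_apply, ofFun]

theorem lieDeriv_one_apply (X Y : VectorField A) (α : Form A 1) :
    lieDeriv X α ![Y] = X (α ![Y]) - α ![⁅X, Y⁆] := by
  rw [show lieDeriv X α ![Y] = (lieDeriv X α).curryLeft Y ![] from rfl, curryLeft_lieDeriv,
    curryLeft_one, curryLeft_one, lieDeriv_ofFun]
  rfl

theorem lieDeriv_zero {k : ℕ} (X : VectorField A) : lieDeriv X (0 : Form A k) = 0 := by
  ext v; simp [lieDeriv_apply]

theorem lieDeriv_sub {k : ℕ} (X : VectorField A) (η θ : Form A k) :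
    lieDeriv X (η - θ) = lieDeriv X η - lieDeriv X θ := by
  rw [eq_sub_iff_add_eq, ← lieDeriv_add, sub_add_cancel]

theorem lieDeriv_wedge {k : ℕ} (X : VectorField A) (α : Form A 1) (η : Form A k) :
    lieDeriv X (wedge α η) = wedge (lieDeriv X α) η + wedge α (lieDeriv X η) := by
  induction k with
  | zero =>
    rw [eq_ofFun η, lieDeriv_ofFun, wedge_ofFun, wedge_ofFun, wedge_ofFun, lieDeriv_smul_fun]
    abel
  | succ k ih =>
    refine form_ext fun Y => ?_
    rw [AlternatingMap.curryLeft_add, LinearMap.add_apply]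
    simp only [curryLeft_lieDeriv, curryLeft_wedge, lieDeriv_sub, lieDeriv_smul_fun, ih,
      wedge_sub, lieDeriv_one_apply]
    module

theorem extDeriv_add {k : ℕ} (η θ : Form A k) :
    extDeriv (η + θ) = extDeriv η + extDeriv θ := (extDerivₗ A k).map_add η θ

theorem extDeriv_sub {k : ℕ} (η θ : Form A k) :
    extDeriv (η - θ) = extDeriv η - extDeriv θ := (extDerivₗ A k).map_sub η θ

theorem extDeriv_fun_smul {k : ℕ} (f : A) (η : Form A k) :
    extDeriv (f • η) = wedge (extDeriv (ofFun f)) η + f • extDeriv η := by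
  ext v
  rw [extDeriv_eq, realDeriv_fun_smul, AlternatingMap.add_apply, wedge_apply,
    AlternatingMap.smul_apply, extDeriv_eq]
  simp only [extDeriv_ofFun, smul_eq_mul]

theorem extDeriv_wedge_of_closed {k : ℕ} (α : Form A 1) (hα : extDeriv α = 0) (η : Form A k) :
    extDeriv (wedge α η) = - wedge α (extDeriv η) := by
  induction k with
  | zero =>
    rw [eq_ofFun η, wedge_ofFun, extDeriv_fun_smul, hα, smul_zero, add_zero, wedge_comm_one]
  | succ k ih =>
    refine form_ext fun X => ?_
    have hL : lieDeriv X α = extDeriv (ofFun (α ![X])) := by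
      have h := curryLeft_extDeriv X α
      rw [hα, AlternatingMap.curryLeft_zero, LinearMap.zero_apply, curryLeft_one] at h
      exact (sub_eq_zero.1 h.symm)
    rw [curryLeft_neg']
    simp only [curryLeft_extDeriv, curryLeft_wedge, lieDeriv_wedge, extDeriv_sub,
      extDeriv_fun_smul, ih, hL, wedge_sub]
    abel

theorem ofFun_add (f g : A) : ofFun (f + g) = ofFun f + ofFun g := rfl

theorem ofFun_smul (t : ℝ) (f : A) : ofFun (t • f) = t • ofFun f := rfl

theorem extDeriv_smul {k : ℕ} (t : ℝ) (η : Form A k) : extDeriv (t • η) = t • extDeriv η :=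
  (extDerivₗ A k).map_smul t η

theorem extDeriv_ofFun_zero : extDeriv (ofFun (0 : A)) = 0 := (extDerivₗ A 0).map_zero

theorem lieDeriv_zero_left {k : ℕ} (η : Form A k) : lieDeriv 0 η = 0 := by
  simpa using lieDeriv_smul_left (0 : ℝ) (0 : VectorField A) η

/-- The linear map `α ↦ α ∧ η` on `1`-forms. -/
def wedgeRight {k : ℕ} (η : Form A k) : Form A 1 →ₗ[ℝ] Form A (k + 1) where
  toFun α := wedge α η
  map_add' α β := add_wedge α β η
  map_smul' t α := by
    rw [RingHom.id_apply, ← algebraMap_smul A t α, smul_wedge, algebraMap_smul]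

/-- The twisted differential `d^b η = d η + b ∧ η`. -/
def twistedDeriv (b : Form A 1) (k : ℕ) : Form A k →ₗ[ℝ] Form A (k + 1) where
  toFun η := extDeriv η + wedge b η
  map_add' η θ := by rw [extDeriv_add, wedge_add]; abel
  map_smul' c η := by
    have h : wedge b (c • η) = c • wedge b η := by
      rw [← algebraMap_smul A c η, wedge_smul, algebraMap_smul]
    rw [RingHom.id_apply, smul_add, extDeriv_smul, h]

theorem two_form_skew (τ : Form A 2) (X Z : VectorField A) : τ ![X, Z] = - τ ![Z, X] := by
  have h := τ.map_swap ![Z, X] (i := 0) (j := 1) (by decide)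
  rw [← h]
  congr 1
  funext i
  fin_cases i <;> simp

theorem two_form_ext {η θ : Form A 2} (h : ∀ Z W, η ![Z, W] = θ ![Z, W]) : η = θ := by
  ext1 v
  have hv : v = ![v 0, v 1] := by funext i; fin_cases i <;> rfl
  rw [hv]; exact h _ _

theorem wedge_one_apply (α β : Form A 1) (Z W : VectorField A) :
    wedge α β ![Z, W] = α ![Z] * β ![W] - α ![W] * β ![Z] := by
  rw [show wedge α β ![Z, W] = (wedge α β).curryLeft Z ![W] from rfl, curryLeft_wedge,
    curryLeft_one, wedge_ofFun]
  simp [mul_comm]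

theorem sum_form_apply {k : ℕ} {ι : Type*} (s : Finset ι) (η : ι → Form A k)
    (v : Fin k → VectorField A) : (∑ i ∈ s, η i) v = ∑ i ∈ s, η i v := by
  classical
  induction s using Finset.induction_on with
  | empty => simp
  | insert a s ha ih => rw [Finset.sum_insert ha, Finset.sum_insert ha, AlternatingMap.add_apply, ih]

theorem frame_coeff {r : ℕ} (τ : Form A 2) (ξ : Fin r → VectorField A) :
    ∃ c : Fin r → Form A 1, ∀ Z j, ∑ i, c i ![Z] * τ ![ξ i, ξ j] =
      (Matrix.of fun i j => τ ![ξ i, ξ j]).det * τ ![Z, ξ j] := by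
  let M : Matrix (Fin r) (Fin r) A := Matrix.of fun i j => τ ![ξ i, ξ j]
  refine ⟨fun i => ∑ l, (-(M.adjugate l i)) • τ.curryLeft (ξ l), fun Z j => ?_⟩
  have hc : ∀ i, (∑ l, (-(M.adjugate l i)) • τ.curryLeft (ξ l) : Form A 1) ![Z] =
      ∑ l, τ ![Z, ξ l] * M.adjugate l i := by
    intro i
    rw [sum_form_apply]
    refine Finset.sum_congr rfl fun l _ => ?_
    rw [two_form_skew τ Z]
    change -(M.adjugate l i) * τ ![ξ l, Z] = _
    ring
  have h := congrFun (Matrix.vecMul_vecMul (fun l => τ ![Z, ξ l]) M.adjugate M) j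
  rw [Matrix.adjugate_mul, Matrix.vecMul_smul, Matrix.vecMul_one] at h
  simp only [hc]
  exact h

theorem frame_expansion {r : ℕ} (τ : Form A 2) (ξ : Fin r → VectorField A) (c : Fin r → Form A 1)
    (D : A) (h : ∀ Z W, D * (D * τ ![Z, W]) = D * ∑ i, c i ![Z] * τ ![ξ i, W]) :
    (D * D + D * D) • τ = D • ∑ i, wedge (c i) (τ.curryLeft (ξ i)) := by
  refine two_form_ext fun Z W => ?_
  have e1 := h Z W
  have e2 := h W Z
  rw [two_form_skew τ W Z] at e2
  rw [AlternatingMap.smul_apply, AlternatingMap.smul_apply, sum_form_apply]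
  simp only [wedge_one_apply, Finset.sum_sub_distrib, smul_eq_mul]
  change _ = D * (∑ i, c i ![Z] * τ ![ξ i, W] - ∑ i, c i ![W] * τ ![ξ i, Z])
  rw [mul_sub, ← e1, ← e2]
  ring

/-- The first de Rham cohomology: closed `1`-forms modulo differentials of functions. -/
abbrev DeRhamH1 (A : Type*) [CommRing A] [Algebra ℝ A] : Type _ :=
  Subquotient (LinearMap.ker (extDerivₗ A 1)) (LinearMap.range (extDerivₗ A 0))

end Algebra

section LinearAlgebra

variable {V W : Type*} [AddCommGroup V] [Module ℝ V] [AddCommGroup W] [Module ℝ W]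

theorem exists_frame (B : V →ₗ[ℝ] W) (ev : V → W →ₗ[ℝ] ℝ) (hev : ∀ w, (∀ v, ev v w = 0) → w = 0)
    (hB : ∀ x y, ev y (B x) = - ev x (B y)) {r : ℕ} (hr : B.rank = r) :
    ∃ ξ : Fin r → V, (Matrix.of fun i j => ev (ξ j) (B (ξ i))).det ≠ 0 := by
  have hfr : Module.finrank ℝ (LinearMap.range B) = r := Module.finrank_eq_of_rank_eq hr
  have : Module.Finite ℝ (LinearMap.range B) := by
    rw [← Module.rank_lt_aleph0_iff]
    exact lt_of_eq_of_lt hr (Cardinal.natCast_lt_aleph0)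
  let β := Module.finBasisOfFinrankEq ℝ (LinearMap.range B) hfr
  have hξ : ∀ i, ∃ x, B x = (β i : W) := fun i => (β i).2
  choose ξ hξ using hξ
  refine ⟨ξ, fun hdet => ?_⟩
  obtain ⟨c, hc0, hc⟩ := Matrix.exists_vecMul_eq_zero_iff.2 hdet
  have hu : ∀ j, ∑ i, c i * ev (ξ j) (B (ξ i)) = 0 := fun j => by
    have := congrFun hc j
    simpa [Matrix.vecMul, dotProduct] using this
  apply hc0
  have hli := Fintype.linearIndependent_iff.1 β.linearIndependent c
  refine funext (hli ?_)
  apply Subtype.ext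
  apply hev
  intro z
  have hz : ∃ a : Fin r → ℝ, B z = ∑ j, a j • B (ξ j) := by
    refine ⟨fun j => β.repr ⟨B z, LinearMap.mem_range_self B z⟩ j, ?_⟩
    have := congrArg Subtype.val (β.sum_repr ⟨B z, LinearMap.mem_range_self B z⟩)
    simp only [hξ]
    exact this.symm.trans (by simp only [Submodule.coe_sum, Submodule.coe_smul])
  obtain ⟨a, ha⟩ := hz
  have h1 : ∀ i, ev z (B (ξ i)) = - ∑ j, a j * ev (ξ i) (B (ξ j)) := by
    intro i
    rw [hB, ha]
    simp
  have h2 : ∑ i, c i * ev z (B (ξ i)) = 0 := by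
    simp only [h1]
    simp only [mul_neg, Finset.sum_neg_distrib, Finset.mul_sum]
    rw [Finset.sum_comm, neg_eq_zero]
    refine Finset.sum_eq_zero fun j _ => ?_
    have := hu j
    calc ∑ i, c i * (a j * ev (ξ i) (B (ξ j))) = - (a j * ∑ i, c i * ev (ξ j) (B (ξ i))) := by
          rw [Finset.mul_sum, ← Finset.sum_neg_distrib]
          refine Finset.sum_congr rfl fun i _ => ?_
          rw [hB (ξ j) (ξ i)]; ring
      _ = 0 := by rw [this]; simp
  simpa [← hξ] using h2

theorem eq_zero_of_frame (B : V →ₗ[ℝ] W) (ev : V → W →ₗ[ℝ] ℝ) {r : ℕ} (hr : B.rank = r)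
    (ξ : Fin r → V) (hdet : (Matrix.of fun i j => ev (ξ j) (B (ξ i))).det ≠ 0) (z : V)
    (hz : ∀ j, ev (ξ j) (B z) = 0) : B z = 0 := by
  have hfr : Module.finrank ℝ (LinearMap.range B) = r := Module.finrank_eq_of_rank_eq hr
  have : Module.Finite ℝ (LinearMap.range B) := by
    rw [← Module.rank_lt_aleph0_iff]
    exact lt_of_eq_of_lt hr (Cardinal.natCast_lt_aleph0)
  have key : ∀ c : Fin r → ℝ, (∀ j, ∑ i, c i * ev (ξ j) (B (ξ i)) = 0) → c = 0 := by
    intro c hc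
    by_contra h
    refine hdet (Matrix.exists_vecMul_eq_zero_iff.1 ⟨c, h, ?_⟩)
    funext j
    simpa [Matrix.vecMul, dotProduct] using hc j
  let e : Fin r → LinearMap.range B := fun i => ⟨B (ξ i), ξ i, rfl⟩
  have hli : LinearIndependent ℝ e := by
    rw [Fintype.linearIndependent_iff]
    intro c hc
    refine congrFun (key c fun j => ?_)
    have := congrArg (fun φ : LinearMap.range B => ev (ξ j) (φ : W)) hc
    simpa [e] using this
  have hspan := hli.span_eq_top_of_card_eq_finrank' (by simp [hfr])
  have hmem : (⟨B z, z, rfl⟩ : LinearMap.range B) ∈ Submodule.span ℝ (Set.range e) := by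
    rw [hspan]; trivial
  obtain ⟨a, ha⟩ := (Submodule.mem_span_range_iff_exists_fun ℝ).1 hmem
  have ha' : B z = ∑ i, a i • B (ξ i) := by
    have := congrArg Subtype.val ha
    simpa [e] using this.symm
  have h0 : a = 0 := key a fun j => by
    have := hz j
    rw [ha'] at this
    simpa using this
  rw [ha', h0]; simp

end LinearAlgebra

section Manifold

variable {m : ℕ} {Y : Type*} [TopologicalSpace Y] [ChartedSpace (EuclideanSpace ℝ (Fin m)) Y]

/-- The algebra of smooth real functions on `Y`. -/
abbrev Func (m : ℕ) (Y : Type*) [TopologicalSpace Y]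
    [ChartedSpace (EuclideanSpace ℝ (Fin m)) Y] : Type _ := C^∞⟮𝓡 m, Y; ℝ⟯

/-- The smooth vector fields on `Y`. -/
abbrev Vect (m : ℕ) (Y : Type*) [TopologicalSpace Y]
    [ChartedSpace (EuclideanSpace ℝ (Fin m)) Y] : Type _ := VectorField (Func m Y)

/-- The smooth differential `k`-forms on `Y`. -/
abbrev Ω (m : ℕ) (Y : Type*) [TopologicalSpace Y]
    [ChartedSpace (EuclideanSpace ℝ (Fin m)) Y] (k : ℕ) : Type _ := Form (Func m Y) k

/-- The bilinear form `(X, Z) ↦ τ_y(X_y, Z_y)` on vector fields, in curried form. As `X_y` runs through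
the whole tangent space at `y`, the rank of this linear map is the rank of the bilinear form `τ_y`. -/
def formAt (τ : Ω m Y 2) (y : Y) : Vect m Y →ₗ[ℝ] Vect m Y →ₗ[ℝ] ℝ :=
  LinearMap.mk₂ ℝ (fun X Z => (τ ![X, Z]) y)
    (fun X X' Z => by
      have := τ.map_vecCons_add ![Z] X X'
      exact congrArg (fun f : Func m Y => f y) this)
    (fun c X Z => by
      have := map_cons_real τ c X ![Z]
      exact congrArg (fun f : Func m Y => f y) this)
    (fun X Z Z' => by
      have := (τ.curryLeft X).map_vecCons_add ![] Z Z'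
      exact congrArg (fun f : Func m Y => f y) this)
    (fun c X Z => by
      have := map_cons_real (τ.curryLeft X) c Z ![]
      exact congrArg (fun f : Func m Y => f y) this)


theorem formAt_apply (τ : Ω m Y 2) (y : Y) (X Z : Vect m Y) : formAt τ y X Z = (τ ![X, Z]) y := rfl

/-- The vector fields `X` with `ι_X τ = 0`: the sections of the null distribution of `τ`. -/
def tangentToNull (τ : Ω m Y 2) : Submodule (Func m Y) (Vect m Y) where
  carrier := {X | ∀ Z, τ ![X, Z] = 0}
  zero_mem' := fun Z => τ.map_coord_zero 0 rfl
  add_mem' := fun {X X'} hX hX' Z => by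
    have := τ.map_vecCons_add ![Z] X X'
    rw [this, hX Z, hX' Z, add_zero]
  smul_mem' := fun f X hX Z => by
    have := τ.map_vecCons_smul ![Z] f X
    rw [this, hX Z, smul_zero]

/-- The restriction of `η` to the distribution with sections `D` is zero. -/
def VanishesOn {k : ℕ} (D : Submodule (Func m Y) (Vect m Y)) (η : Ω m Y k) : Prop :=
  ∀ v : Fin k → Vect m Y, (∀ i, v i ∈ D) → η v = 0

/-- A differential ideal of forms: in each degree a `C^∞(Y)`-submodule, stable under wedge products and
under the exterior derivative, and determined locally (a form which belongs to the ideal near each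
point belongs to it; `χ` below is a function that is invertible near `y`). As forms are locally
generated by functions and `1`-forms, wedge products with a `1`-form suffice. -/
structure IsDifferentialIdeal (J : ∀ k, Submodule (Func m Y) (Ω m Y k)) : Prop where
  wedge_mem : ∀ {k : ℕ} (α : Ω m Y 1) (η : Ω m Y k), η ∈ J k → wedge α η ∈ J (k + 1)
  mem_wedge : ∀ {k : ℕ} (α : Ω m Y 1) (η : Ω m Y k), α ∈ J 1 → wedge α η ∈ J (k + 1)
  extDeriv_mem : ∀ {k : ℕ} (η : Ω m Y k), η ∈ J k → extDeriv η ∈ J (k + 1)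
  local_mem : ∀ {k : ℕ} (η : Ω m Y k),
    (∀ y : Y, ∃ χ : Func m Y, χ y ≠ 0 ∧ χ • η ∈ J k) → η ∈ J k

/-- The degree `k` part of the differential ideal generated by the set `S` of `1`-forms. -/
def differentialIdeal (S : Set (Ω m Y 1)) (k : ℕ) : Submodule (Func m Y) (Ω m Y k) where
  carrier := {η | ∀ J : ∀ k, Submodule (Func m Y) (Ω m Y k),
    IsDifferentialIdeal J → S ⊆ J 1 → η ∈ J k}
  zero_mem' := fun J _ _ => (J k).zero_mem
  add_mem' := fun h h' J hJ hS => (J k).add_mem (h J hJ hS) (h' J hJ hS)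
  smul_mem' := fun f _ h J hJ hS => (J k).smul_mem f (h J hJ hS)

theorem isDifferentialIdeal (S : Set (Ω m Y 1)) : IsDifferentialIdeal (differentialIdeal S) where
  wedge_mem α η h J hJ hS := hJ.wedge_mem α η (h J hJ hS)
  mem_wedge α η h J hJ hS := hJ.mem_wedge α η (h J hJ hS)
  extDeriv_mem η h J hJ hS := hJ.extDeriv_mem η (h J hJ hS)
  local_mem η h J hJ hS := hJ.local_mem η fun y =>
    let ⟨χ, hχ, hm⟩ := h y
    ⟨χ, hχ, hm J hJ hS⟩

/-- A locally conformal pre-symplectic form on `Y`: a `2`-form of constant rank and a closed `1`-form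
(the Lee form) `b` with `d^b form = 0`. -/
structure LCPSForm (m : ℕ) (Y : Type*) [TopologicalSpace Y]
    [ChartedSpace (EuclideanSpace ℝ (Fin m)) Y] where
  /-- the `2`-form -/
  form : Ω m Y 2
  /-- the Lee form `b` -/
  lee : Ω m Y 1
  lee_closed : extDeriv lee = 0
  twisted_closed : twistedDeriv lee 2 form = 0
  constant_rank : ∃ r : ℕ, ∀ y : Y, (formAt form y).rank = r

namespace LCPSForm

variable (S : LCPSForm m Y)

/-- The sections of `T𝓕`, where `𝓕` is the null foliation. -/
abbrev TF : Submodule (Func m Y) (Vect m Y) := tangentToNull S.form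

/-- The annihilator of `T𝓕`: the `1`-forms that vanish on `T𝓕`. -/
def annihilator : Set (Ω m Y 1) := {α | VanishesOn S.TF α}

/-- `Ω^k(Y, form, 𝓕)`: the `k`-forms in the differential ideal generated by the annihilator of `T𝓕`. -/
def ideal (k : ℕ) : Submodule ℝ (Ω m Y k) :=
  (differentialIdeal S.annihilator k).restrictScalars ℝ

theorem form_mem_ideal : S.form ∈ S.ideal 2 := by
  obtain ⟨r, hr⟩ := S.constant_rank
  refine (isDifferentialIdeal S.annihilator).local_mem S.form fun y => ?_
  let ev : Vect m Y → (Vect m Y →ₗ[ℝ] ℝ) →ₗ[ℝ] ℝ := fun X => LinearMap.applyₗ X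
  obtain ⟨ξ, hξ⟩ := exists_frame (formAt S.form y) ev (fun w h => LinearMap.ext h)
    (fun X Z => by
      change (S.form ![X, Z]) y = - (S.form ![Z, X]) y
      rw [two_form_skew]; rfl) (hr y)
  obtain ⟨c, hcM⟩ := frame_coeff S.form ξ
  generalize hDdef : (Matrix.of fun i j => S.form ![ξ i, ξ j]).det = D at hcM
  have hD : ∀ x : Y, D x = (Matrix.of fun i j => ev (ξ j) (formAt S.form x (ξ i))).det := by
    intro x
    have h := RingHom.map_det (ContMDiffMap.evalRingHom x : Func m Y →+* ℝ)
      (Matrix.of fun i j => S.form ![ξ i, ξ j])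
    rw [hDdef] at h
    exact h
  have hker : ∀ Z W, D * (D * S.form ![Z, W]) = D * ∑ i, c i ![Z] * S.form ![ξ i, W] := by
    intro Z W
    ext x
    change D x * (D x * (S.form ![Z, W]) x) = D x * (∑ i, c i ![Z] * S.form ![ξ i, W] : Func m Y) x
    by_cases hx : D x = 0
    · rw [hx, zero_mul, zero_mul]
    congr 1
    have hB := eq_zero_of_frame (formAt S.form x) ev (hr x) ξ (by rwa [← hD])
      ((D x) • Z - ∑ i, (c i ![Z] x) • ξ i) (fun j => by
        have h : ∑ i, (c i ![Z]) x * (S.form ![ξ i, ξ j]) x = D x * (S.form ![Z, ξ j]) x := by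
          have h := congrArg (ContMDiffMap.evalRingHom x : Func m Y →+* ℝ) (hcM Z j)
          rw [map_sum, map_mul] at h
          simp only [map_mul] at h
          exact h
        change formAt S.form x ((D x) • Z - ∑ i, (c i ![Z] x) • ξ i) (ξ j) = 0
        simp only [map_sub, map_smul, map_sum, LinearMap.sub_apply, LinearMap.smul_apply,
          LinearMap.sum_apply, formAt_apply, smul_eq_mul, h, sub_self])
    have h := congrArg (fun φ : Vect m Y →ₗ[ℝ] ℝ => φ W) hB
    simp only [map_sub, map_smul, map_sum, LinearMap.sub_apply, LinearMap.smul_apply,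
      LinearMap.sum_apply, formAt_apply, smul_eq_mul, LinearMap.zero_apply, sub_eq_zero] at h
    rw [h]
    have h2 := map_sum (ContMDiffMap.evalRingHom x : Func m Y →+* ℝ)
      (fun i => c i ![Z] * S.form ![ξ i, W]) Finset.univ
    simp only [map_mul] at h2
    exact h2.symm
  refine ⟨D * D + D * D, ?_, ?_⟩
  · change D y * D y + D y * D y ≠ 0
    have h : D y ≠ 0 := by rw [hD]; exact hξ
    have h' := mul_self_pos.2 h
    exact (add_pos h' h').ne'
  rw [frame_expansion S.form ξ c D hker]
  refine Submodule.smul_mem _ _ (Submodule.sum_mem _ fun i _ => ?_)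
  refine (isDifferentialIdeal S.annihilator).wedge_mem _ _ fun J hJ hS => hS fun v hv => ?_
  have hv0 : v = ![v 0] := by funext j; fin_cases j; rfl
  rw [hv0]
  change S.form ![ξ i, v 0] = 0
  rw [two_form_skew, hv 0, neg_zero]

/-- `Ω^*(Y, form, 𝓕)` is a subcomplex for `d^b`. -/
theorem twistedDeriv_mem_ideal {k : ℕ} (η : Ω m Y k) (h : η ∈ S.ideal k) :
    twistedDeriv S.lee k η ∈ S.ideal (k + 1) :=
  (S.ideal (k + 1)).add_mem ((isDifferentialIdeal S.annihilator).extDeriv_mem η h)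
    ((isDifferentialIdeal S.annihilator).wedge_mem S.lee η h)

/-- The `d^b`-closed elements of `Ω^k(Y, form, 𝓕)`. -/
def twistedCocycles (k : ℕ) : Submodule ℝ (Ω m Y k) :=
  LinearMap.ker (twistedDeriv S.lee k) ⊓ S.ideal k

/-- The image of `Ω^(k-1)(Y, form, 𝓕)` under `d^b`. -/
def twistedCoboundaries : ∀ k : ℕ, Submodule ℝ (Ω m Y k)
  | 0 => ⊥
  | k + 1 => (S.ideal k).map (twistedDeriv S.lee k)

/-- The cohomology `H_b^k(Y, form, 𝓕)` of the complex `Ω^*(Y, form, 𝓕)` with differential `d^b`. -/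
abbrev H (k : ℕ) : Type _ := Subquotient (S.twistedCocycles k) (S.twistedCoboundaries k)

theorem form_mem_cocycles : S.form ∈ S.twistedCocycles 2 := ⟨S.twisted_closed, S.form_mem_ideal⟩

/-- The class of the l.c.p-s. form itself in `H_b^2(Y, form, 𝓕)`. -/
def formClass : S.H 2 := Subquotient.mk _ _ ⟨S.form, S.form_mem_cocycles⟩

theorem wedge_form_mem_cocycles (γ : Ω m Y 1) (hγ : extDeriv γ = 0) :
    wedge γ S.form ∈ S.twistedCocycles 3 := by
  refine ⟨?_, (isDifferentialIdeal S.annihilator).wedge_mem γ _ S.form_mem_ideal⟩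
  change extDeriv (wedge γ S.form) + wedge S.lee (wedge γ S.form) = 0
  rw [extDeriv_wedge_of_closed γ hγ, wedge_wedge, ← neg_add, ← wedge_add]
  have h : extDeriv S.form + wedge S.lee S.form = 0 := S.twisted_closed
  rw [h, wedge_zero, neg_zero]

theorem wedge_form_mem_coboundaries (f : Ω m Y 0) :
    wedge (extDeriv f) S.form ∈ S.twistedCoboundaries 3 := by
  refine ⟨(f ![]) • S.form, (differentialIdeal S.annihilator 2).smul_mem _ S.form_mem_ideal, ?_⟩
  change extDeriv _ + wedge S.lee _ = _
  have h : extDeriv S.form + wedge S.lee S.form = 0 := S.twisted_closed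
  rw [extDeriv_fun_smul, ← eq_ofFun, wedge_smul, add_assoc, ← smul_add, h, smul_zero, add_zero]

/-- The map `H^1(Y; ℝ) → H_b^3(Y, form, 𝓕)`, `[γ] ↦ [γ ∧ form]`. -/
def L : DeRhamH1 (Func m Y) →ₗ[ℝ] S.H 3 :=
  Subquotient.map (wedgeRight S.form)
    (fun γ hγ => S.wedge_form_mem_cocycles γ hγ)
    (fun _ ⟨f, hf⟩ => hf ▸ S.wedge_form_mem_coboundaries f)

/-- The infinitesimal bulk deformations: pairs `(κ, c)` of a `2`-form and a `1`-form with
`d^b κ = - c ∧ form`, `d c = 0`, and `κ` restricts to zero on `𝓕`. -/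
def infinitesimalDeformations : Submodule ℝ (Ω m Y 2 × Ω m Y 1) where
  carrier := {p | twistedDeriv S.lee 2 p.1 = - wedge p.2 S.form ∧ extDeriv p.2 = 0 ∧
    VanishesOn S.TF p.1}
  zero_mem' := by
    refine ⟨?_, (extDerivₗ _ 1).map_zero, fun v _ => rfl⟩
    change twistedDeriv S.lee 2 0 = - wedge 0 S.form
    rw [map_zero, zero_wedge, neg_zero]
  add_mem' := by
    rintro ⟨κ, c⟩ ⟨κ', c'⟩ ⟨h1, h2, h3⟩ ⟨h1', h2', h3'⟩
    simp only at h1 h2 h3 h1' h2' h3'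
    refine ⟨?_, ?_, ?_⟩
    · change twistedDeriv S.lee 2 (κ + κ') = - wedge (c + c') S.form
      rw [map_add, h1, h1', add_wedge, neg_add]
    · change extDeriv (c + c') = 0
      rw [extDeriv_add, h2, h2', add_zero]
    · intro v hv
      change κ v + κ' v = 0
      rw [h3 v hv, h3' v hv, add_zero]
  smul_mem' := by
    rintro t ⟨κ, c⟩ ⟨h1, h2, h3⟩
    simp only at h1 h2 h3
    refine ⟨?_, ?_, ?_⟩
    · change twistedDeriv S.lee 2 (t • κ) = - (wedgeRight S.form (t • c))
      rw [map_smul, map_smul, h1, smul_neg]; rfl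
    · change extDerivₗ _ 1 (t • c) = 0
      rw [map_smul]
      change t • extDeriv c = 0
      rw [h2, smul_zero]
    · intro v hv
      change t • κ v = 0
      rw [h3 v hv, smul_zero]

/-- Infinitesimal equivalence of pairs: there are a vector field `ξ` and a function `f` with
`κ' = - f form + κ + L_ξ form` and `c' = c + L_ξ b + d f`. -/
def Equivalent (p' p : Ω m Y 2 × Ω m Y 1) : Prop :=
  ∃ (ξ : Vect m Y) (f : Func m Y),
    p'.1 = -(f • S.form) + p.1 + lieDeriv ξ S.form ∧
    p'.2 = p.2 + lieDeriv ξ S.lee + extDeriv (ofFun f)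

/-- The pairs that are equivalent to zero. -/
def trivialDeformations : Submodule ℝ (Ω m Y 2 × Ω m Y 1) where
  carrier := {p | S.Equivalent p 0}
  zero_mem' := by
    refine ⟨0, 0, ?_, ?_⟩
    · rw [lieDeriv_zero_left]; simp
    · rw [lieDeriv_zero_left, extDeriv_ofFun_zero]; simp
  add_mem' := by
    rintro ⟨κ, c⟩ ⟨κ', c'⟩ ⟨ξ, f, h1, h2⟩ ⟨ξ', f', h1', h2'⟩
    simp only at h1 h2 h1' h2'
    refine ⟨ξ + ξ', f + f', ?_, ?_⟩
    · simp only [lieDeriv_add_left, add_smul, Prod.fst_add, Prod.fst_zero, h1, h1']; abel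
    · simp only [lieDeriv_add_left, ofFun_add, extDeriv_add, Prod.snd_add, Prod.snd_zero, h2, h2']
      abel
  smul_mem' := by
    rintro t ⟨κ, c⟩ ⟨ξ, f, h1, h2⟩
    simp only at h1 h2
    refine ⟨t • ξ, t • f, ?_, ?_⟩
    · simp only [lieDeriv_smul_left, smul_assoc, Prod.smul_fst, Prod.fst_zero, h1]
      module
    · simp only [lieDeriv_smul_left, ofFun_smul, extDeriv_smul, Prod.smul_snd, Prod.snd_zero, h2]
      module

/-- Two pairs are equivalent exactly when their difference is equivalent to zero. -/
theorem equivalent_iff (p' p : Ω m Y 2 × Ω m Y 1) :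
    S.Equivalent p' p ↔ p' - p ∈ S.trivialDeformations := by
  refine exists_congr fun ξ => exists_congr fun f => and_congr ?_ ?_
  · rw [Prod.fst_sub, sub_eq_iff_eq_add, Prod.fst_zero, add_zero, add_right_comm]
  · rw [Prod.snd_sub, sub_eq_iff_eq_add, Prod.snd_zero]
    constructor <;> intro h <;> rw [h] <;> abel

/-- The space of equivalence classes of infinitesimal bulk deformations. -/
abbrev Def : Type _ := Subquotient S.infinitesimalDeformations S.trivialDeformations

end LCPSForm

end Manifold
end LCPS
end

/-! Write ω for the form and b for its Lee form. Cartan's formula with `d^b ω = 0` gives `L_ξ ω =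
d^b(ι_ξ ω) - b(ξ) ω`, and `db = 0` gives `L_ξ b = d(b(ξ))`. With `β = ι_ξ ω` and `g = f + b(ξ)`, a
pair equivalent to zero is therefore `(-gω + d^b β, dg)` (`mem_trivialDeformations_iff`).

Constant rank now identifies the data with the complex `Ω^*(Y, ω, 𝓕)`. Every `1`-form annihilating
`T𝓕` is some `ι_ξ ω` (`exists_contraction_eq`), so β runs through all of degree `1`. A `2`-form
vanishes on `𝓕` exactly when it lies in the ideal (`mem_ideal_of_vanishesOn`,
`vanishesOn_of_mem_ideal`). Both rest on `exists_local_frame`, an inversion of ω transverse to `𝓕`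
by Cramer's rule. It multiplies by a determinant instead of dividing by it, so all objects remain
globally defined.

The rest is linear algebra: `[κ] ↦ [(κ, 0)]` and `[(κ, c)] ↦ [c]` form an exact sequence `H_b^2 →
Def → ker L → 0`. The kernel of the first map is the line of `[ω]`, because `dg = 0` forces g to be
constant on a connected manifold. An exact sequence of vector spaces splits. -/

open scoped Manifold ContDiff

noncomputable section

namespace LCPS

open Function

/-! ### Cramer's rule, frame expansions and Cartan identities for forms -/

section Algebra

variable {A : Type*} [CommRing A] [Algebra ℝ A]

/-- A `1`-form as a linear functional on vector fields. -/
def oneFormₗ (α : Form A 1) : VectorField A →ₗ[A] A where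
  toFun X := α ![X]
  map_add' X Y := α.map_vecCons_add ![] X Y
  map_smul' f X := α.map_vecCons_smul ![] f X

theorem oneFormₗ_apply (α : Form A 1) (X : VectorField A) : oneFormₗ α X = α ![X] := rfl

/-- A `2`-form as a bilinear form on vector fields. -/
def twoFormₗ (τ : Form A 2) : VectorField A →ₗ[A] VectorField A →ₗ[A] A where
  toFun X := oneFormₗ (τ.curryLeft X)
  map_add' X Y := by
    ext Z; exact τ.map_vecCons_add ![Z] X Y
  map_smul' f X := by
    ext Z; exact τ.map_vecCons_smul ![Z] f X

theorem twoFormₗ_apply (τ : Form A 2) (X Z : VectorField A) : twoFormₗ τ X Z = τ ![X, Z] := rfl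

theorem one_form_ext {α β : Form A 1} (h : ∀ Z, α ![Z] = β ![Z]) : α = β := by
  ext1 v
  have hv : v = ![v 0] := by funext i; fin_cases i; rfl
  rw [hv]; exact h _

/-- The coefficients of the expansion in a frame are contractions of the form. -/
theorem frame_coeff_contraction {r : ℕ} (τ : Form A 2) (ξ : Fin r → VectorField A) :
    ∃ η : Fin r → VectorField A, ∀ Z j, ∑ i, τ ![η i, Z] * τ ![ξ i, ξ j] =
      (Matrix.of fun i j => τ ![ξ i, ξ j]).det * τ ![Z, ξ j] := by
  let M : Matrix (Fin r) (Fin r) A := Matrix.of fun i j => τ ![ξ i, ξ j]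
  -- Cramer's rule: the row `τ(Z, ξ l)` times `adj M` times `M` is `det M` times the row. The minus
  -- sign moves `Z` to the second slot, so that the coefficients become contractions of `τ`.
  refine ⟨fun i => ∑ l, (-(M.adjugate l i)) • ξ l, fun Z j => ?_⟩
  have hc : ∀ i, τ ![∑ l, (-(M.adjugate l i)) • ξ l, Z] =
      ∑ l, τ ![Z, ξ l] * M.adjugate l i := by
    intro i
    rw [← twoFormₗ_apply, map_sum, LinearMap.sum_apply]
    refine Finset.sum_congr rfl fun l _ => ?_
    rw [two_form_skew τ Z, map_smul, LinearMap.smul_apply, twoFormₗ_apply, smul_eq_mul]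
    ring
  have h := congrFun (Matrix.vecMul_vecMul (fun l => τ ![Z, ξ l]) M.adjugate M) j
  rw [Matrix.adjugate_mul, Matrix.vecMul_smul, Matrix.vecMul_one] at h
  simp only [hc]
  exact h

/-- If `E Z - ∑ i, (c i)(Z) ξ i` always lies in a distribution on which `κ` vanishes, then `κ` is
generated by the `c i` up to the factor `2 E²`. -/
theorem two_form_expansion {r : ℕ} (κ : Form A 2) (E : A) (c : Fin r → Form A 1)
    (ξ : Fin r → VectorField A)
    (h : ∀ Z W, κ ![E • Z - ∑ i, c i ![Z] • ξ i, E • W - ∑ i, c i ![W] • ξ i] = 0) :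
    (2 * E * E) • κ = (2 * E) • ∑ i, wedge (c i) (κ.curryLeft (ξ i)) -
      ∑ i, wedge (c i) (∑ j, κ ![ξ i, ξ j] • c j) := by
  refine two_form_ext fun Z W => ?_
  have e := h Z W
  rw [← twoFormₗ_apply] at e
  simp only [map_sub, map_smul, map_sum, LinearMap.sub_apply, LinearMap.smul_apply,
    LinearMap.sum_apply, twoFormₗ_apply, smul_eq_mul] at e
  rw [AlternatingMap.sub_apply, AlternatingMap.smul_apply, AlternatingMap.smul_apply,
    sum_form_apply, sum_form_apply]
  simp only [wedge_one_apply, sum_form_apply, AlternatingMap.smul_apply, smul_eq_mul,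
    AlternatingMap.curryLeft_apply_apply]
  have hZ : ∀ i, κ ![Z, ξ i] = - κ ![ξ i, Z] := fun i => two_form_skew _ _ _
  simp only [hZ] at e
  -- With `P Z = ∑ c i(Z) ξ i`, both halves of the double wedge sum reduce, up to sign, to `κ(P Z, P
  -- W)`. It is thus counted twice, which is why the identity carries the factor `2`.
  have h3 : ∑ i, c i ![W] * ∑ j, κ ![ξ i, ξ j] * c j ![Z] =
      - ∑ i, c i ![W] * ∑ j, c j ![Z] * κ ![ξ j, ξ i] := by
    rw [← Finset.sum_neg_distrib]
    refine Finset.sum_congr rfl fun i _ => ?_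
    rw [← mul_neg, ← Finset.sum_neg_distrib]
    congr 1
    refine Finset.sum_congr rfl fun j _ => ?_
    rw [two_form_skew κ (ξ i)]; ring
  have h4 : ∑ i, c i ![Z] * ∑ j, κ ![ξ i, ξ j] * c j ![W] =
      ∑ i, c i ![W] * ∑ j, c j ![Z] * κ ![ξ j, ξ i] := by
    simp only [Finset.mul_sum]
    rw [Finset.sum_comm]
    exact Finset.sum_congr rfl fun i _ => Finset.sum_congr rfl fun j _ => by ring
  rw [Finset.sum_sub_distrib, Finset.sum_sub_distrib, h3, h4]
  have h5 : ∑ i, c i ![W] * (-(E * κ ![ξ i, Z]) - ∑ j, c j ![Z] * κ ![ξ j, ξ i]) =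
      -(E * ∑ i, c i ![W] * κ ![ξ i, Z]) - ∑ i, c i ![W] * ∑ j, c j ![Z] * κ ![ξ j, ξ i] := by
    rw [Finset.mul_sum, ← Finset.sum_neg_distrib, ← Finset.sum_sub_distrib]
    exact Finset.sum_congr rfl fun i _ => by ring
  simp only [mul_neg] at e
  rw [h5] at e
  linear_combination 2 * e

/-- Cartan's formula without the `ι_ξ db` term; it makes the change of the Lee form exact. -/
theorem lieDeriv_one_of_closed {b : Form A 1} (hb : extDeriv b = 0) (ξ : VectorField A) :
    lieDeriv ξ b = extDeriv (ofFun (b ![ξ])) := by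
  have h := curryLeft_extDeriv ξ b
  rw [hb, AlternatingMap.curryLeft_zero, LinearMap.zero_apply, curryLeft_one] at h
  exact sub_eq_zero.1 h.symm

/-- Cartan's formula with `dη = -b ∧ η`: contracting `b ∧ η` gives `b(ξ) η - b ∧ ι_ξ η`, and the
second term completes `d ι_ξ η` to `d^b ι_ξ η`. -/
theorem lieDeriv_of_twisted_closed {k : ℕ} {b : Form A 1} {η : Form A (k + 1)}
    (h : twistedDeriv b (k + 1) η = 0) (ξ : VectorField A) :
    lieDeriv ξ η = twistedDeriv b k (η.curryLeft ξ) - b ![ξ] • η := by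
  have h1 := curryLeft_extDeriv ξ η
  have h2 : extDeriv η = - wedge b η := eq_neg_of_add_eq_zero_left h
  rw [h2, curryLeft_neg', curryLeft_wedge] at h1
  change _ = extDeriv (η.curryLeft ξ) + wedge b (η.curryLeft ξ) - _
  rw [eq_comm, sub_eq_iff_eq_add] at h1
  rw [h1]; abel

theorem twistedDeriv_fun_smul {k : ℕ} (b : Form A 1) (f : A) (η : Form A k) :
    twistedDeriv b k (f • η) = wedge (extDeriv (ofFun f)) η + f • twistedDeriv b k η := by
  change extDeriv (f • η) + wedge b (f • η) = _ + f • (extDeriv η + wedge b η)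
  rw [extDeriv_fun_smul, wedge_smul, smul_add, add_assoc]

end Algebra

/-! ### Classes in subquotients -/

section LinearAlgebra

variable {V W : Type*} [AddCommGroup V] [Module ℝ V] [AddCommGroup W] [Module ℝ W]

theorem Subquotient.mk_surjective (Z B : Submodule ℝ V) : Surjective (Subquotient.mk Z B) :=
  (B.submoduleOf Z).mkQ_surjective

theorem Subquotient.mk_eq_zero {Z B : Submodule ℝ V} {z : Z} :
    Subquotient.mk Z B z = 0 ↔ (z : V) ∈ B :=
  Submodule.Quotient.mk_eq_zero _

end LinearAlgebra

/-! ### Local frames, involutivity, and the ideal of the null foliation -/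

section Manifold

variable {m : ℕ} {Y : Type*} [TopologicalSpace Y] [ChartedSpace (EuclideanSpace ℝ (Fin m)) Y]

namespace LCPSForm

variable (S : LCPSForm m Y)

/-- Near each point, a multiple of every vector field is a combination of a fixed frame plus a vector
field tangent to the null foliation. -/
theorem exists_local_frame (y : Y) : ∃ (r : ℕ) (ξ η : Fin r → Vect m Y) (E : Func m Y),
    E y ≠ 0 ∧ ∀ Z, E • Z - ∑ i, S.form ![η i, Z] • ξ i ∈ S.TF := by
  obtain ⟨r, hr⟩ := S.constant_rank
  let ev : Vect m Y → (Vect m Y →ₗ[ℝ] ℝ) →ₗ[ℝ] ℝ := fun X => LinearMap.applyₗ X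
  obtain ⟨ξ, hξ⟩ := exists_frame (formAt S.form y) ev (fun w h => LinearMap.ext h)
    (fun X Z => by
      change (S.form ![X, Z]) y = - (S.form ![Z, X]) y
      rw [two_form_skew]; rfl) (hr y)
  obtain ⟨η, hηM⟩ := frame_coeff_contraction S.form ξ
  generalize hDdef : (Matrix.of fun i j => S.form ![ξ i, ξ j]).det = D at hηM
  have hD : ∀ x : Y, D x = (Matrix.of fun i j => ev (ξ j) (formAt S.form x (ξ i))).det := by
    intro x
    have h := RingHom.map_det (ContMDiffMap.evalRingHom x : Func m Y →+* ℝ)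
      (Matrix.of fun i j => S.form ![ξ i, ξ j])
    rw [hDdef] at h
    exact h
  -- At a point with `D ≠ 0` the rank is still `r`, so the `ξ i` span a complement of the kernel
  -- there, and a vector pairing to zero with all `ξ j` is null. At the zeros of `D` the extra
  -- factor `D` makes the identity trivial.
  have hker : ∀ Z W, D * (D * S.form ![Z, W]) =
      D * ∑ i, S.form ![η i, Z] * S.form ![ξ i, W] := by
    intro Z W
    ext x
    change D x * (D x * (S.form ![Z, W]) x) =
      D x * (∑ i, S.form ![η i, Z] * S.form ![ξ i, W] : Func m Y) x
    by_cases hx : D x = 0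
    · rw [hx, zero_mul, zero_mul]
    congr 1
    have hB := eq_zero_of_frame (formAt S.form x) ev (hr x) ξ (by rwa [← hD])
      ((D x) • Z - ∑ i, (S.form ![η i, Z] x) • ξ i) (fun j => by
        have h : ∑ i, (S.form ![η i, Z]) x * (S.form ![ξ i, ξ j]) x =
            D x * (S.form ![Z, ξ j]) x := by
          have h := congrArg (ContMDiffMap.evalRingHom x : Func m Y →+* ℝ) (hηM Z j)
          rw [map_sum, map_mul] at h
          simp only [map_mul] at h
          exact h
        change formAt S.form x ((D x) • Z - ∑ i, (S.form ![η i, Z] x) • ξ i) (ξ j) = 0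
        simp only [map_sub, map_smul, map_sum, LinearMap.sub_apply, LinearMap.smul_apply,
          LinearMap.sum_apply, formAt_apply, smul_eq_mul, h, sub_self])
    have h := congrArg (fun φ : Vect m Y →ₗ[ℝ] ℝ => φ W) hB
    simp only [map_sub, map_smul, map_sum, LinearMap.sub_apply, LinearMap.smul_apply,
      LinearMap.sum_apply, formAt_apply, smul_eq_mul, LinearMap.zero_apply, sub_eq_zero] at h
    rw [h]
    have h2 := map_sum (ContMDiffMap.evalRingHom x : Func m Y →+* ℝ)
      (fun i => S.form ![η i, Z] * S.form ![ξ i, W]) Finset.univ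
    simp only [map_mul] at h2
    exact h2.symm
  -- The extra factor `D` in `hker` is absorbed into both `E = D²` and the contracting fields.
  refine ⟨r, ξ, fun i => D • η i, D * D, ?_, fun Z W => ?_⟩
  · have h : D y ≠ 0 := by rw [hD]; exact hξ
    exact mul_ne_zero h h
  rw [← twoFormₗ_apply]
  simp only [← twoFormₗ_apply S.form _ Z]
  simp only [map_sub, map_smul, map_sum, LinearMap.sub_apply, LinearMap.smul_apply,
    LinearMap.sum_apply, twoFormₗ_apply, smul_eq_mul, mul_assoc, hker, ← Finset.mul_sum, sub_self]

/-- The null distribution is involutive. -/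
theorem lie_mem_TF {X Z : Vect m Y} (hX : X ∈ S.TF) (hZ : Z ∈ S.TF) : ⁅X, Z⁆ ∈ S.TF := by
  intro W
  have hιX : S.form.curryLeft X = 0 := one_form_ext fun W => hX W
  have hιZ : S.form.curryLeft Z = 0 := one_form_ext fun W => hZ W
  -- As `ι_X ω = 0`, the derivative `L_X ω` is the multiple `-b(X) ω`. Contracting with `Z` and
  -- using `ι_Z L_X = L_X ι_Z - ι_[X,Z]` leaves `ι_[X,Z] ω = 0`.
  have h := congrArg (fun η : Ω m Y 2 => η.curryLeft Z)
    (lieDeriv_of_twisted_closed S.twisted_closed X)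
  simp only [curryLeft_lieDeriv, hιX, map_zero, hιZ, lieDeriv_zero, zero_sub] at h
  have h' : (b : Func m Y) → (-(b • S.form)).curryLeft Z = 0 := fun b => by
    change -(b • S.form.curryLeft Z) = 0
    rw [hιZ, smul_zero, neg_zero]
  rw [h'] at h
  exact congrArg (fun α : Ω m Y 1 => α ![W]) (neg_eq_zero.1 h)

/-- The `k`-forms that vanish on the null foliation. -/
def vanishing (k : ℕ) : Submodule (Func m Y) (Ω m Y k) where
  carrier := {η | VanishesOn S.TF η}
  zero_mem' := fun _ _ => rfl
  add_mem' := fun {η θ} h h' v hv => by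
    rw [AlternatingMap.add_apply, h v hv, h' v hv, add_zero]
  smul_mem' := fun f η h v hv => by
    rw [AlternatingMap.smul_apply, h v hv, smul_zero]

/-- Stability under `d` is Frobenius: the brackets in the formula for `dη` remain in `T𝓕` by
`lie_mem_TF`. Locality holds because vanishing can be tested at each point. -/
theorem isDifferentialIdeal_vanishing : IsDifferentialIdeal S.vanishing where
  wedge_mem α η h v hv := by
    rw [wedge_apply]
    refine Finset.sum_eq_zero fun i _ => ?_
    rw [h (i.removeNth v) fun j => hv _, mul_zero, smul_zero]
  mem_wedge α η h v hv := by
    rw [wedge_apply]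
    refine Finset.sum_eq_zero fun i _ => ?_
    rw [h ![v i] fun j => by simpa using hv i, zero_mul, smul_zero]
  extDeriv_mem {k} η h v hv := by
    rw [extDeriv_eq, realDeriv_apply]
    have h0 : ∀ i : Fin (k + 1), η (i.removeNth v) = 0 := fun i => h _ fun j => hv _
    refine (congrArg _ (Finset.sum_eq_zero fun i _ => ?_)).trans (smul_zero _)
    rw [lieDeriv_apply, h0, map_zero, zero_sub, zero_add]
    rw [Finset.sum_eq_zero, neg_zero, smul_zero]
    intro j _
    refine h _ fun l => ?_
    by_cases hl : l = j
    · subst hl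
      rw [update_self]
      exact S.lie_mem_TF (hv _) (hv _)
    · rw [update_of_ne hl]
      exact hv _
  local_mem η h v hv := by
    ext y
    obtain ⟨χ, hχ, hm⟩ := h y
    have h1 := congrArg (fun f : Func m Y => f y) (hm v hv)
    exact (mul_eq_zero.1 (show χ y * η v y = 0 from h1)).resolve_left hχ

/-- The generated ideal is the smallest one, and the forms vanishing on `𝓕` are a competitor. -/
theorem vanishesOn_of_mem_ideal {k : ℕ} {η : Ω m Y k} (h : η ∈ S.ideal k) :
    VanishesOn S.TF η :=
  h S.vanishing S.isDifferentialIdeal_vanishing fun _ hα => hα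

theorem annihilator_subset_ideal {α : Ω m Y 1} (h : α ∈ S.annihilator) : α ∈ S.ideal 1 :=
  fun _ _ hS => hS h

theorem curryLeft_form_mem_annihilator (ξ : Vect m Y) :
    S.form.curryLeft ξ ∈ S.annihilator := by
  intro v hv
  have hv' : v = ![v 0] := by funext i; fin_cases i; rfl
  rw [hv']
  change S.form ![ξ, v 0] = 0
  rw [two_form_skew, hv 0, neg_zero]

/-- A `2`-form belongs to the differential ideal when it vanishes on the null foliation. -/
theorem mem_ideal_of_vanishesOn {κ : Ω m Y 2} (h : VanishesOn S.TF κ) : κ ∈ S.ideal 2 := by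
  have hI := isDifferentialIdeal S.annihilator
  refine hI.local_mem κ fun y => ?_
  obtain ⟨r, ξ, η, E, hE, hTF⟩ := S.exists_local_frame y
  -- The factor in `two_form_expansion`, which writes `2E² κ` through the forms `ι_(η i) ω`; these
  -- annihilate `T𝓕`.
  refine ⟨2 * E * E, ?_, ?_⟩
  · rw [mul_assoc, two_mul]
    change E y * E y + E y * E y ≠ 0
    have h := mul_self_pos.2 hE
    exact (add_pos h h).ne'
  have hc := fun i => S.annihilator_subset_ideal (S.curryLeft_form_mem_annihilator (η i))
  rw [two_form_expansion κ E (fun i => S.form.curryLeft (η i)) ξ fun Z W =>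
    h _ fun i => by fin_cases i; exacts [hTF Z, hTF W]]
  refine Submodule.sub_mem _ (Submodule.smul_mem _ _ (Submodule.sum_mem _ fun i _ => ?_))
    (Submodule.sum_mem _ fun i _ => ?_)
  · exact hI.mem_wedge _ _ (hc i)
  · exact hI.mem_wedge _ _ (hc i)

end LCPSForm

end Manifold
-- Locally finite sums of functions and vector fields
section Manifold

open scoped Topology

variable {m : ℕ} {Y : Type*} [TopologicalSpace Y] [ChartedSpace (EuclideanSpace ℝ (Fin m)) Y]

section LocallyFiniteSum

variable {ι : Type*} (ρ : ι → Func m Y) (hρ : LocallyFinite fun i => support (ρ i))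

theorem contMDiff_finsum_mul {ρ : ι → Func m Y}
    (hρ : LocallyFinite fun i => support (ρ i)) (g : ι → Func m Y) :
    ContMDiff (𝓡 m) 𝓘(ℝ, ℝ) ∞ fun y => ∑ᶠ i, ρ i y * g i y := by
  refine contMDiff_finsum (fun i => (ρ i * g i).contMDiff) (hρ.subset fun i y hy => ?_)
  exact left_ne_zero_of_mul hy

/-- The locally finite sum `∑ i, ρ i • g i` of functions. -/
def locallyFiniteSum (g : ι → Func m Y) : Func m Y :=
  ⟨fun y => ∑ᶠ i, ρ i y * g i y, contMDiff_finsum_mul hρ g⟩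

theorem locallyFiniteSum_apply (g : ι → Func m Y) (y : Y) :
    locallyFiniteSum ρ hρ g y = ∑ᶠ i, ρ i y * g i y := rfl

/-- Near each point, a locally finite sum is a finite sum. -/
theorem exists_finset_locallyFiniteSum (y : Y) : ∃ U ∈ 𝓝 y, ∃ s : Finset ι,
    ∀ (g : ι → Func m Y), ∀ x ∈ U, locallyFiniteSum ρ hρ g x = ∑ i ∈ s, ρ i x * g i x := by
  obtain ⟨U, hU, hfin⟩ := hρ y
  refine ⟨U, hU, hfin.toFinset, fun g x hx => ?_⟩
  rw [locallyFiniteSum_apply]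
  refine finsum_eq_sum_of_support_subset _ fun i hi => ?_
  rw [Set.Finite.coe_toFinset]
  exact ⟨x, left_ne_zero_of_mul hi, hx⟩

/-- The locally finite sum `∑ i, ρ i • X i` of vector fields. -/
def locallyFiniteSumVect (X : ι → Vect m Y) : Vect m Y :=
  Derivation.mk'
    { toFun := fun f => locallyFiniteSum ρ hρ fun i => X i f
      map_add' := fun f g => by
        ext y
        obtain ⟨U, hU, s, hs⟩ := exists_finset_locallyFiniteSum ρ hρ y
        have hy := mem_of_mem_nhds hU
        change _ = locallyFiniteSum ρ hρ _ y + locallyFiniteSum ρ hρ _ y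
        rw [hs _ y hy, hs _ y hy, hs _ y hy, ← Finset.sum_add_distrib]
        refine Finset.sum_congr rfl fun i _ => ?_
        rw [map_add, ← mul_add]; rfl
      map_smul' := fun c f => by
        ext y
        obtain ⟨U, hU, s, hs⟩ := exists_finset_locallyFiniteSum ρ hρ y
        have hy := mem_of_mem_nhds hU
        change _ = c * locallyFiniteSum ρ hρ _ y
        rw [hs _ y hy, hs _ y hy, Finset.mul_sum]
        refine Finset.sum_congr rfl fun i _ => ?_
        rw [(X i).map_smul, mul_left_comm]; rfl }
    fun f g => by
      ext y
      obtain ⟨U, hU, s, hs⟩ := exists_finset_locallyFiniteSum ρ hρ y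
      have hy := mem_of_mem_nhds hU
      change locallyFiniteSum ρ hρ _ y =
        f y * locallyFiniteSum ρ hρ _ y + g y * locallyFiniteSum ρ hρ _ y
      rw [hs _ y hy, hs _ y hy, hs _ y hy, Finset.mul_sum, Finset.mul_sum,
        ← Finset.sum_add_distrib]
      refine Finset.sum_congr rfl fun i _ => ?_
      have h : X i (f * g) y = f y * X i g y + g y * X i f y :=
        congrArg (fun f : Func m Y => f y) ((X i).leibniz f g)
      rw [h]; ring

variable [IsManifold (𝓡 m) ∞ Y] [T2Space Y]

/-- Linearity over functions makes `φ` local: after multiplication by a bump function the sum is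
finite, and the bump function equals `1` at the point of evaluation. -/
theorem linear_locallyFiniteSumVect (φ : Vect m Y →ₗ[Func m Y] Func m Y) (X : ι → Vect m Y) :
    φ (locallyFiniteSumVect ρ hρ X) = locallyFiniteSum ρ hρ fun i => φ (X i) := by
  ext y
  obtain ⟨U, hU, s, hs⟩ := exists_finset_locallyFiniteSum ρ hρ y
  obtain ⟨f, -, hf⟩ := (SmoothBumpFunction.nhds_basis_support (I := 𝓡 m) hU).mem_iff.1 hU
  let χ : Func m Y := ⟨f, f.contMDiff⟩
  have hχ : χ • locallyFiniteSumVect ρ hρ X = χ • ∑ i ∈ s, ρ i • X i := by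
    ext g x
    change χ x * locallyFiniteSum ρ hρ (fun i => X i g) x =
      χ x * ((∑ i ∈ s, ρ i • X i : Vect m Y) g) x
    by_cases hx : χ x = 0
    · rw [hx, zero_mul, zero_mul]
    rw [hs _ x (hf hx)]
    congr 1
    rw [show (∑ i ∈ s, ρ i • X i : Vect m Y) g = ∑ i ∈ s, (ρ i • X i) g from
      map_sum (AddMonoidHom.mk' (fun D : Vect m Y => D g) fun _ _ => rfl) _ _]
    exact (map_sum (ContMDiffMap.evalRingHom x : Func m Y →+* ℝ) (fun i => (ρ i • X i) g) s).symm
  have h := congrArg (fun g : Func m Y => g y) (congrArg φ hχ)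
  simp only [map_smul, map_sum] at h
  have h1 : χ y = 1 := f.eq_one
  change χ y * _ = χ y * _ at h
  rw [h1, one_mul, one_mul] at h
  rw [h, hs _ y (mem_of_mem_nhds hU)]
  exact map_sum (ContMDiffMap.evalRingHom y : Func m Y →+* ℝ) _ _

end LocallyFiniteSum

/-! ### Functions with zero differential -/

section ConstantFunctions

variable [IsManifold (𝓡 m) ∞ Y]

/-- The derivative of a function in the chart at `x`, in a constant direction. -/
theorem contMDiffOn_chart_fderiv (x : Y) (e : EuclideanSpace ℝ (Fin m)) (f : Func m Y) :
    ContMDiffOn (𝓡 m) 𝓘(ℝ, ℝ) ∞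
      (fun y => fderiv ℝ (f ∘ (chartAt (EuclideanSpace ℝ (Fin m)) x).symm)
        (chartAt (EuclideanSpace ℝ (Fin m)) x y) e)
      (chartAt (EuclideanSpace ℝ (Fin m)) x).source := by
  set φ := chartAt (EuclideanSpace ℝ (Fin m)) x
  have h1 : ContDiffOn ℝ ∞ (f ∘ φ.symm) φ.target :=
    (f.contMDiff.comp_contMDiffOn (contMDiffOn_chart_symm (I := 𝓡 m))).contDiffOn
  have h2 : ContDiffOn ℝ ∞ (fun z => fderiv ℝ (f ∘ φ.symm) z e) φ.target :=
    (h1.fderiv_of_isOpen φ.open_target (by simp)).clm_apply contDiffOn_const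
  exact h2.contMDiffOn.comp (contMDiffOn_chart (I := 𝓡 m)) φ.mapsTo

theorem differentiableAt_comp_chart_symm (x : Y) (f : Func m Y) {z : EuclideanSpace ℝ (Fin m)}
    (hz : z ∈ (chartAt (EuclideanSpace ℝ (Fin m)) x).target) :
    DifferentiableAt ℝ (f ∘ (chartAt (EuclideanSpace ℝ (Fin m)) x).symm) z := by
  have h1 : ContDiffOn ℝ ∞ (f ∘ (chartAt (EuclideanSpace ℝ (Fin m)) x).symm)
      (chartAt (EuclideanSpace ℝ (Fin m)) x).target :=
    (f.contMDiff.comp_contMDiffOn (contMDiffOn_chart_symm (I := 𝓡 m))).contDiffOn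
  exact (h1.contDiffAt ((chartAt _ x).open_target.mem_nhds hz)).differentiableAt (by simp)

variable [T2Space Y]

/-- A coordinate vector field of the chart at `x`, cut off by a bump function. -/
def coordVect {x : Y} (χ : SmoothBumpFunction (𝓡 m) x) (e : EuclideanSpace ℝ (Fin m)) :
    Vect m Y :=
  Derivation.mk'
    { toFun := fun f => ⟨_, χ.contMDiff_smul (contMDiffOn_chart_fderiv x e f)⟩
      map_add' := fun f g => by
        ext y
        change χ y * fderiv ℝ ((f ∘ (chartAt _ x).symm) + (g ∘ (chartAt _ x).symm)) _ e =
          χ y * fderiv ℝ _ _ e + χ y * fderiv ℝ _ _ e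
        -- Outside the chart domain the bump function is zero, so the value of `fderiv` there is
        -- irrelevant.
        by_cases hy : y ∈ (chartAt (EuclideanSpace ℝ (Fin m)) x).source
        · have hz := (chartAt (EuclideanSpace ℝ (Fin m)) x).map_source hy
          rw [fderiv_add (differentiableAt_comp_chart_symm x f hz)
            (differentiableAt_comp_chart_symm x g hz), ← mul_add]
          rfl
        · have h0 : χ y = 0 := notMem_support.1 fun h => hy (χ.support_subset_source h)
          rw [h0]; ring
      map_smul' := fun c f => by
        ext y
        change χ y * fderiv ℝ (c • (f ∘ (chartAt _ x).symm)) _ e = c * (χ y * fderiv ℝ _ _ e)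
        by_cases hy : y ∈ (chartAt (EuclideanSpace ℝ (Fin m)) x).source
        · have hz := (chartAt (EuclideanSpace ℝ (Fin m)) x).map_source hy
          rw [fderiv_const_smul (differentiableAt_comp_chart_symm x f hz), mul_left_comm]
          rfl
        · have h0 : χ y = 0 := notMem_support.1 fun h => hy (χ.support_subset_source h)
          rw [h0]; ring }
    fun f g => by
      ext y
      change χ y * fderiv ℝ ((f ∘ (chartAt _ x).symm) * (g ∘ (chartAt _ x).symm)) _ e =
          f y * (χ y * fderiv ℝ _ _ e) + g y * (χ y * fderiv ℝ _ _ e)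
      by_cases hy : y ∈ (chartAt (EuclideanSpace ℝ (Fin m)) x).source
      · have hz := (chartAt (EuclideanSpace ℝ (Fin m)) x).map_source hy
        rw [fderiv_mul (differentiableAt_comp_chart_symm x f hz)
          (differentiableAt_comp_chart_symm x g hz)]
        simp only [add_apply, smul_apply,
          comp_apply, (chartAt (EuclideanSpace ℝ (Fin m)) x).left_inv hy, smul_eq_mul]
        ring
      · have h0 : χ y = 0 := notMem_support.1 fun h => hy (χ.support_subset_source h)
        rw [h0]; ring

theorem coordVect_apply {x : Y} (χ : SmoothBumpFunction (𝓡 m) x) (e : EuclideanSpace ℝ (Fin m))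
    (f : Func m Y) (y : Y) : coordVect χ e f y =
      χ y * fderiv ℝ (f ∘ (chartAt (EuclideanSpace ℝ (Fin m)) x).symm)
        (chartAt (EuclideanSpace ℝ (Fin m)) x y) e := rfl

/-- A function killed by all vector fields is locally constant. -/
theorem isLocallyConstant_of_forall_vect {g : Func m Y} (h : ∀ X : Vect m Y, X g = 0) :
    IsLocallyConstant g := by
  rw [IsLocallyConstant.iff_eventually_eq]
  intro x
  set φ := chartAt (EuclideanSpace ℝ (Fin m)) x with hφ
  obtain ⟨χ⟩ : Nonempty (SmoothBumpFunction (𝓡 m) x) := inferInstance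
  have hx : x ∈ φ.source := mem_chart_source _ x
  have hopen : IsOpen (φ '' support χ) :=
    φ.isOpen_image_of_subset_source χ.isOpen_support χ.support_subset_source
  have hsub : φ '' support χ ⊆ φ.target := by
    rintro _ ⟨y, hy, rfl⟩
    exact φ.map_source (χ.support_subset_source hy)
  obtain ⟨r, hr, hball⟩ := Metric.isOpen_iff.1 hopen (φ x) ⟨x, χ.c_mem_support, rfl⟩
  have hconst : ∀ z ∈ Metric.ball (φ x) r, (g ∘ φ.symm) z = (g ∘ φ.symm) (φ x) := by
    intro z hz
    refine Metric.isOpen_ball.is_const_of_fderiv_eq_zero (𝕜 := ℝ)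
      (convex_ball (φ x) r).isPreconnected (fun w hw =>
      (differentiableAt_comp_chart_symm x g (hsub (hball hw))).differentiableWithinAt) ?_ hz
      (Metric.mem_ball_self hr)
    -- The ball lies in the image of the support of `χ`, so the factor `χ y` can be cancelled from
    -- the coordinate derivative.
    intro w hw
    ext1 e
    obtain ⟨y, hy, rfl⟩ := hball hw
    have h1 := coordVect_apply χ e g y
    rw [h (coordVect χ e)] at h1
    exact (mul_eq_zero.1 h1.symm).resolve_left hy
  filter_upwards [φ.open_source.mem_nhds hx,
    (φ.continuousAt hx).preimage_mem_nhds (Metric.ball_mem_nhds _ hr)] with y hy hyr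
  have h2 := hconst _ hyr
  simpa only [comp_apply, φ.left_inv hy, φ.left_inv hx] using h2

/-- A function with zero differential on a connected manifold is constant. -/
theorem eq_algebraMap_of_extDeriv_eq_zero [PreconnectedSpace Y] [Nonempty Y] {g : Func m Y}
    (h : extDeriv (ofFun g) = 0) : ∃ t : ℝ, g = algebraMap ℝ (Func m Y) t := by
  have hX : ∀ X : Vect m Y, X g = 0 := fun X => by
    rw [← extDeriv_ofFun, h]; rfl
  obtain ⟨y₀⟩ := ‹Nonempty Y›
  refine ⟨g y₀, ?_⟩
  ext y
  exact (isLocallyConstant_of_forall_vect hX).apply_eq_of_preconnectedSpace y y₀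

end ConstantFunctions

end Manifold
-- Scalar identities for forms, and splitting of exact sequences
section Algebra

variable {A : Type*} [CommRing A] [Algebra ℝ A] {k : ℕ}

theorem form_sub_smul (f g : A) (η : Form A k) : (f - g) • η = f • η - g • η := by
  ext v
  simp only [AlternatingMap.smul_apply, AlternatingMap.sub_apply, smul_eq_mul, sub_mul]

theorem form_neg_smul (f : A) (η : Form A k) : (-f) • η = -(f • η) := by
  ext v
  simp only [AlternatingMap.smul_apply, AlternatingMap.neg_apply, smul_eq_mul, neg_mul]

theorem form_neg_real_smul (t : ℝ) (η : Form A k) : (-t) • η = -(t • η) := by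
  ext v
  simp only [AlternatingMap.smul_apply, AlternatingMap.neg_apply, neg_smul]

end Algebra

section LinearAlgebra

variable {U V W : Type*} [AddCommGroup U] [Module ℝ U] [AddCommGroup V] [Module ℝ V]
  [AddCommGroup W] [Module ℝ W]

/-- A short exact sequence of vector spaces splits, with the left-hand term presented as a quotient. -/
theorem nonempty_equiv_quotient_prod_of_exact (N : Submodule ℝ U) (f : U →ₗ[ℝ] V) (p : V →ₗ[ℝ] W)
    (hN : LinearMap.ker f = N) (hp : Surjective p) (hfp : LinearMap.range f = LinearMap.ker p) :
    Nonempty (V ≃ₗ[ℝ] (U ⧸ N) × W) := by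
  subst hN
  obtain ⟨s, hs⟩ := p.exists_rightInverse_of_surjective (LinearMap.range_eq_top.2 hp)
  have hinj : Injective ((LinearMap.ker f).liftQ f le_rfl) :=
    LinearMap.ker_eq_bot.1 (Submodule.ker_liftQ_eq_bot _ _ _ le_rfl)
  exact ⟨(lequivProdOfRightSplitExact hinj ((Submodule.range_liftQ _ _ _).trans hfp) hs).symm⟩

end LinearAlgebra

/-! ### Annihilating `1`-forms as contractions, and the trivial deformations -/

section Manifold

variable {m : ℕ} {Y : Type*} [TopologicalSpace Y] [ChartedSpace (EuclideanSpace ℝ (Fin m)) Y]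

namespace LCPSForm

variable (S : LCPSForm m Y)

/-- The identity holds on all of `Y`; only the nonvanishing of the factor is local. Nonnegativity is
what allows such factors to be summed without cancellation. -/
theorem exists_local_contraction_eq {α : Ω m Y 1} (hα : α ∈ S.annihilator) (y : Y) :
    ∃ (E : Func m Y) (X : Vect m Y), (∀ x, 0 ≤ E x) ∧ E y ≠ 0 ∧ S.form.curryLeft X = E • α := by
  obtain ⟨r, ξ, η, E, hE, hTF⟩ := S.exists_local_frame y
  -- Applying `α` to `E Z - ∑ ω(η i, Z) ξ i` gives `E α(Z) = ω(∑ α(ξ i) η i, Z)`; a second factor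
  -- `E` makes the coefficient a square.
  refine ⟨E * E, E • ∑ i, α ![ξ i] • η i, fun x => mul_self_nonneg (E x), mul_ne_zero hE hE,
    one_form_ext fun Z => ?_⟩
  have h : α ![E • Z - ∑ i, S.form ![η i, Z] • ξ i] = 0 := hα _ fun i => by
    fin_cases i; exact hTF Z
  rw [← oneFormₗ_apply] at h
  simp only [map_sub, map_smul, map_sum, smul_eq_mul, oneFormₗ_apply, sub_eq_zero] at h
  change S.form ![E • ∑ i, α ![ξ i] • η i, Z] = (E * E) * α ![Z]
  rw [← twoFormₗ_apply]
  simp only [map_smul, map_sum, LinearMap.smul_apply, LinearMap.sum_apply, smul_eq_mul,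
    twoFormₗ_apply]
  rw [mul_assoc, h]
  congr 1
  exact Finset.sum_congr rfl fun i _ => mul_comm _ _

/-- Replaces the geometric condition on `κ` by membership in the complex that computes `H_b`. -/
theorem mem_infinitesimalDeformations_iff {p : Ω m Y 2 × Ω m Y 1} :
    p ∈ S.infinitesimalDeformations ↔ twistedDeriv S.lee 2 p.1 = - wedge p.2 S.form ∧
      extDeriv p.2 = 0 ∧ p.1 ∈ S.ideal 2 :=
  ⟨fun ⟨h1, h2, h3⟩ => ⟨h1, h2, S.mem_ideal_of_vanishesOn h3⟩,
    fun ⟨h1, h2, h3⟩ => ⟨h1, h2, S.vanishesOn_of_mem_ideal h3⟩⟩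

variable [IsManifold (𝓡 m) ∞ Y] [T2Space Y] [SecondCountableTopology Y]

/-- As the rank is constant, every `1`-form that vanishes on the null foliation is a contraction of
the l.c.p-s. form. -/
theorem exists_contraction_eq {α : Ω m Y 1} (hα : α ∈ S.annihilator) :
    ∃ ξ : Vect m Y, S.form.curryLeft ξ = α := by
  have : LocallyCompactSpace Y := Manifold.locallyCompact_of_finiteDimensional (𝓡 m)
  choose E X hE0 hE hX using S.exists_local_contraction_eq hα
  obtain ⟨ρ, hρ⟩ := SmoothPartitionOfUnity.exists_isSubordinate (𝓡 m) (isClosed_univ (X := Y))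
    (fun y => {x | E y x ≠ 0}) (fun y => isOpen_ne_fun (E y).contMDiff.continuous continuous_const)
    (fun y _ => Set.mem_iUnion.2 ⟨y, hE y⟩)
  have hfin := ρ.locallyFinite
  -- All terms are nonnegative, and some `ρ i` is positive at `x`; subordination then gives `E i x ≠
  -- 0`.
  have hT : ∀ x, locallyFiniteSum ρ hfin E x ≠ 0 := by
    intro x
    obtain ⟨i, hi⟩ := ρ.exists_pos_of_mem (Set.mem_univ x)
    have hEi : E i x ≠ 0 := hρ i (subset_tsupport _ hi.ne')
    rw [locallyFiniteSum_apply]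
    refine (finsum_pos (fun j => mul_nonneg (ρ.nonneg j x) (hE0 j x))
      ⟨i, mul_pos hi ((hE0 i x).lt_of_ne' hEi)⟩ ((hfin.point_finite x).subset fun j hj => ?_)).ne'
    exact left_ne_zero_of_mul hj
  let T' : Func m Y := ⟨fun x => (locallyFiniteSum ρ hfin E x)⁻¹,
    (locallyFiniteSum ρ hfin E).contMDiff.inv₀ hT⟩
  -- Contracting `ω` with `∑ ρ i X i` gives `(∑ ρ i E i) α`, so one global division suffices.
  refine ⟨T' • locallyFiniteSumVect ρ hfin X, one_form_ext fun Z => ?_⟩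
  change S.form ![T' • locallyFiniteSumVect ρ hfin X, Z] = α ![Z]
  rw [← twoFormₗ_apply, map_smul, LinearMap.smul_apply]
  have h := linear_locallyFiniteSumVect ρ hfin ((twoFormₗ S.form).flip Z) X
  rw [LinearMap.flip_apply] at h
  rw [h]
  ext x
  change (locallyFiniteSum ρ hfin E x)⁻¹ * locallyFiniteSum ρ hfin _ x = α ![Z] x
  have h2 : locallyFiniteSum ρ hfin (fun i => (twoFormₗ S.form).flip Z (X i)) x =
      locallyFiniteSum ρ hfin E x * α ![Z] x := by
    rw [locallyFiniteSum_apply, locallyFiniteSum_apply, finsum_mul' _ _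
      ((hfin.point_finite x).subset fun j hj => left_ne_zero_of_mul hj)]
    refine finsum_congr fun i => ?_
    have h3 : (twoFormₗ S.form).flip Z (X i) = E i * α ![Z] :=
      congrArg (fun β : Ω m Y 1 => β ![Z]) (hX i)
    rw [h3, mul_assoc]
    rfl
  rw [h2, inv_mul_cancel_left₀ (hT x)]

/-- The trivial deformations are the pairs `(-g form + d^b β, d g)`, where `β` vanishes on the null
foliation. -/
theorem mem_trivialDeformations_iff {p : Ω m Y 2 × Ω m Y 1} :
    p ∈ S.trivialDeformations ↔ ∃ (g : Func m Y) (β : Ω m Y 1), β ∈ S.ideal 1 ∧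
      p.1 = -(g • S.form) + twistedDeriv S.lee 1 β ∧ p.2 = extDeriv (ofFun g) := by
  have key : ∀ ξ : Vect m Y, lieDeriv ξ S.form =
      twistedDeriv S.lee 1 (S.form.curryLeft ξ) - S.lee ![ξ] • S.form :=
    lieDeriv_of_twisted_closed S.twisted_closed
  constructor
  · rintro ⟨ξ, f, h1, h2⟩
    refine ⟨f + S.lee ![ξ], S.form.curryLeft ξ,
      S.annihilator_subset_ideal (S.curryLeft_form_mem_annihilator ξ), ?_, ?_⟩
    · rw [h1, key, Prod.fst_zero, add_smul]; abel
    · rw [h2, lieDeriv_one_of_closed S.lee_closed, ofFun_add, extDeriv_add, Prod.snd_zero]; abel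
  · rintro ⟨g, β, hβ, h1, h2⟩
    obtain ⟨ξ, rfl⟩ := S.exists_contraction_eq (α := β) (S.vanishesOn_of_mem_ideal hβ)
    -- Inverts the substitution `g = f + b(ξ)` once `β` is written as `ι_ξ ω`.
    refine ⟨ξ, g - S.lee ![ξ], ?_, ?_⟩
    · have h : (g - S.lee ![ξ]) • S.form = g • S.form - S.lee ![ξ] • S.form := form_sub_smul _ _ _
      rw [h1, key, Prod.fst_zero, h]; abel
    · have h : ofFun (g - S.lee ![ξ]) = ofFun g - ofFun (S.lee ![ξ]) := rfl
      rw [h2, lieDeriv_one_of_closed S.lee_closed, Prod.snd_zero, h, extDeriv_sub]; abel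

/-! ### The exact sequence and its splitting -/

/-- The map `H_b^2(Y, form, 𝓕) → Def`, `[κ] ↦ [(κ, 0)]`. -/
def cohomologyToDef : S.H 2 →ₗ[ℝ] S.Def :=
  Subquotient.map (LinearMap.inl ℝ (Ω m Y 2) (Ω m Y 1))
    (fun κ hκ => S.mem_infinitesimalDeformations_iff.2
      ⟨by
        change twistedDeriv S.lee 2 κ = - wedge 0 S.form
        rw [LinearMap.mem_ker.1 hκ.1, zero_wedge, neg_zero],
      (extDerivₗ _ 1).map_zero, hκ.2⟩)
    (fun κ hκ => by
      obtain ⟨β, hβ, rfl⟩ := hκ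
      refine S.mem_trivialDeformations_iff.2 ⟨0, β, hβ, ?_, extDeriv_ofFun_zero.symm⟩
      rw [zero_smul, neg_zero, zero_add]; rfl)

/-- The map `Def → H^1(Y; ℝ)`, `[(κ, c)] ↦ [c]`. -/
def defToDeRham : S.Def →ₗ[ℝ] DeRhamH1 (Func m Y) :=
  Subquotient.map (LinearMap.snd ℝ (Ω m Y 2) (Ω m Y 1))
    (fun _ hp => (S.mem_infinitesimalDeformations_iff.1 hp).2.1)
    (fun _ hp =>
      let ⟨g, _, _, _, h⟩ := S.mem_trivialDeformations_iff.1 hp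
      ⟨ofFun g, h.symm⟩)

/-- The equation `d^b κ = -c ∧ ω` says exactly that `-κ` is a primitive of `c ∧ ω` in the complex.
-/
theorem range_defToDeRham : LinearMap.range S.defToDeRham = LinearMap.ker S.L := by
  apply le_antisymm
  · rintro _ ⟨x, rfl⟩
    obtain ⟨⟨p, hp⟩, rfl⟩ := Subquotient.mk_surjective _ _ x
    obtain ⟨h1, h2, h3⟩ := S.mem_infinitesimalDeformations_iff.1 hp
    refine Subquotient.mk_eq_zero.2 ⟨-p.1, (S.ideal 2).neg_mem h3, ?_⟩
    rw [map_neg, h1, neg_neg]; rfl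
  · intro x hx
    obtain ⟨⟨c, hc⟩, rfl⟩ := Subquotient.mk_surjective _ _ x
    obtain ⟨κ, hκ, h⟩ := Subquotient.mk_eq_zero.1 hx
    have hp : (-κ, c) ∈ S.infinitesimalDeformations :=
      S.mem_infinitesimalDeformations_iff.2
        ⟨by rw [map_neg, h]; rfl, hc, (S.ideal 2).neg_mem hκ⟩
    exact ⟨Subquotient.mk _ _ ⟨_, hp⟩, rfl⟩

/-- If `c = dg`, the equivalence with `ξ = 0` and `f = -g` moves `(κ, c)` to `(κ + gω, 0)`, whose
first entry is `d^b`-closed because `d^b(gω) = dg ∧ ω`. -/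
theorem range_cohomologyToDef : LinearMap.range S.cohomologyToDef = LinearMap.ker S.defToDeRham := by
  apply le_antisymm
  · rintro _ ⟨x, rfl⟩
    obtain ⟨κ, rfl⟩ := Subquotient.mk_surjective _ _ x
    exact Subquotient.mk_eq_zero.2 (Submodule.zero_mem _)
  · intro x hx
    obtain ⟨⟨⟨κ, c⟩, hp⟩, rfl⟩ := Subquotient.mk_surjective _ _ x
    obtain ⟨g, hg⟩ : c ∈ LinearMap.range (extDerivₗ _ 0) := Subquotient.mk_eq_zero.1 hx
    obtain ⟨h1, h2, h3⟩ := S.mem_infinitesimalDeformations_iff.1 hp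
    have hg' : c = extDeriv (ofFun (g ![])) := by rw [← eq_ofFun]; exact hg.symm
    have hκ : κ + g ![] • S.form ∈ S.twistedCocycles 2 := by
      refine ⟨?_, (S.ideal 2).add_mem h3
        ((differentialIdeal S.annihilator 2).smul_mem _ S.form_mem_ideal)⟩
      change twistedDeriv S.lee 2 _ = 0
      rw [map_add, h1, twistedDeriv_fun_smul, S.twisted_closed, smul_zero,
        add_zero, ← hg', neg_add_cancel]
    refine ⟨Subquotient.mk _ _ ⟨_, hκ⟩, sub_eq_zero.1 ?_⟩
    refine Subquotient.mk_eq_zero.2 (S.mem_trivialDeformations_iff.2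
      ⟨-(g ![]), 0, Submodule.zero_mem _, ?_, ?_⟩)
    · change κ + g ![] • S.form - κ = _
      have h : (-(g ![])) • S.form = -(g ![] • S.form) := form_neg_smul _ _
      rw [map_zero, h, neg_neg, add_zero, add_sub_cancel_left]
    · change 0 - c = extDerivₗ _ 0 (-(ofFun (g ![])))
      rw [map_neg, zero_sub, hg']; rfl

/-- If `(κ, 0)` is trivial then `dg = 0`, so `g` is a constant `t` by connectedness and `κ = -tω +
d^b β`. -/
theorem ker_cohomologyToDef [ConnectedSpace Y] :
    LinearMap.ker S.cohomologyToDef = Submodule.span ℝ {S.formClass} := by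
  apply le_antisymm
  · intro x hx
    obtain ⟨⟨κ, hκ⟩, rfl⟩ := Subquotient.mk_surjective _ _ x
    obtain ⟨g, β, hβ, h1, h2⟩ := S.mem_trivialDeformations_iff.1 (Subquotient.mk_eq_zero.1 hx)
    obtain ⟨t, rfl⟩ := eq_algebraMap_of_extDeriv_eq_zero h2.symm
    refine Submodule.mem_span_singleton.2 ⟨-t, (sub_eq_zero.1 ?_).symm⟩
    refine Subquotient.mk_eq_zero.2 ⟨β, hβ, ?_⟩
    change _ = κ - (-t) • S.form
    change κ = _ at h1
    have h : (-t) • S.form = -(t • S.form) := form_neg_real_smul _ _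
    rw [h1, algebraMap_smul, h]; abel
  · rw [Submodule.span_singleton_le_iff_mem]
    -- Conversely `g = -1`, `β = 0` exhibits `(ω, 0)` as trivial: rescaling `ω` by a constant leaves
    -- `b` fixed.
    refine Subquotient.mk_eq_zero.2 (S.mem_trivialDeformations_iff.2
      ⟨-1, 0, Submodule.zero_mem _, ?_, ?_⟩)
    · have h : (-1 : Func m Y) • S.form = -S.form := by
        rw [form_neg_smul, one_smul]
      rw [map_zero, h, neg_neg, add_zero]; rfl
    · ext v
      have hv : v = ![v 0] := by funext i; fin_cases i; rfl
      rw [hv, extDeriv_ofFun, map_neg, Derivation.map_one_eq_zero, neg_zero]; rfl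

end LCPSForm

end Manifold
end LCPS
end

theorem theorem12p3 (m : ℕ) (Y : Type*) [TopologicalSpace Y]
    [ChartedSpace (EuclideanSpace ℝ (Fin m)) Y] [IsManifold (𝓡 m) ∞ Y]
    [T2Space Y] [SecondCountableTopology Y] [ConnectedSpace Y] (S : LCPS.LCPSForm m Y) :
    Nonempty (S.Def ≃ₗ[ℝ]
      (S.H 2 ⧸ Submodule.span ℝ {S.formClass}) × LinearMap.ker S.L) := by
  -- With `ker L` rewritten as a range, the projection becomes surjective by construction.
  rw [← S.range_defToDeRham]
  refine LCPS.nonempty_equiv_quotient_prod_of_exact _ S.cohomologyToDef S.defToDeRham.rangeRestrict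
    S.ker_cohomologyToDef S.defToDeRham.surjective_rangeRestrict ?_
  rw [S.range_cohomologyToDef, LinearMap.ker_rangeRestrict]
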